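/- Let $G=(V,E)$ be a finite simple undirected graph with $n$ vertices and maximum degree $\Delta(G)$, let $\omega:E\to\mathbb{Q}$ be edge weights (possibly negative), and let $k\in\mathbb{N}$. For $E'\subseteq E$ write $\omega(E')=\sum_{e\in E'}\omega(e)$. In LS Max Cut one is given $(G,\omega,(A,B),k)$, where $(A,B)$ is a partition of $V$ (parts may be empty), and asks for a set $S\subseteq V$ with $|S|\le k$ and $\omega(E(A,B))<\omega(E(A\oplus S,B\oplus S))$, where $E(X,Y)$ is the set of edges with one endpoint in $X$ and the other in $Y$ and $\oplus$ is the symmetric difference. In LS Max $3$-Cut one is given $(G,\omega,\chi,k)$ with a coloring $\chi:V\to\{1,2,3\}$ and asks for a coloring $\chi':V\to\{1,2,3\}$ that differs from $\chi$ on at most $k$ vertices and satisfies $\omega(E(\chi'))>\omega(E(\chi))$, where $E(\chi)$ is the set of edges whose endpoints have different colors under $\chi$. An algorithm solves the problem if, on every instance, it halts and returns such an $S$ (respectively $\chi'$) if one exists, and otherwise reports that none exists. The computation model is the random access machine with unit-cost operations (addition, subtraction and comparison of natural numbers and of rational weights, and indirect array access); the graph is given by adjacency lists, in any order. **Corollary.**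 There are an algorithm solving LS Max Cut and an absolute constant $C$ such that on every instance with $\Delta(G)\ge 2$ and $k\ge 1$ it takes at most $$C\cdot e^k\cdot(\Delta(G)-1)^{k+1}\cdot k^2\cdot n$$ steps; and there are an algorithm solving LS Max $3$-Cut and an absolute constant $C$ such that on every instance with $\Delta(G)\ge 2$ and $k\ge 1$ it takes at most $$C\cdot(2e)^k\cdot(\Delta(G)-1)^{k+1}\cdot k^2\cdot n$$ steps. Here $e$ is Euler's number. -/

import Mathlib

namespace LocalCut

/-! ### Unit-cost random access machines

A machine has natural-number registers, natural-number arrays, rational registers and rational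
arrays, all addressed by natural numbers; array cells are addressed indirectly through registers.
A program is a fixed finite command and so uses finitely many registers and arrays. Naturals can be
added, subtracted (truncated at `0`) and compared; rationals can be added, subtracted and compared.
Every such operation, every array access and every evaluation of a test takes one step. -/

/-- The memory contents of the machine. -/
@[ext]
structure State where
  /-- natural-number registers -/
  reg : ℕ → ℕ
  /-- natural-number arrays: `arr a i` is cell `i` of array `a` -/
  arr : ℕ → ℕ → ℕ
  /-- rational registers -/
  wreg : ℕ → ℚ
  /-- rational arrays: `warr a i` is cell `i` of array `a` -/
  warr : ℕ → ℕ → ℚ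

/-- Tests on registers. -/
inductive Test where
  | lt (x y : ℕ)
  | eq (x y : ℕ)
  | wlt (x y : ℕ)
  | not (b : Test)

/-- The truth of a test in a given state. -/
def Test.Holds : Test → State → Prop
  | lt x y, s => s.reg x < s.reg y
  | eq x y, s => s.reg x = s.reg y
  | wlt x y, s => s.wreg x < s.wreg y
  | not b, s => ¬ b.Holds s

/-- Elementary instructions. -/
inductive Instr where
  /-- `reg x := c` -/
  | const (x c : ℕ)
  /-- `reg x := reg y` -/
  | copy (x y : ℕ)
  /-- `reg x := reg y + reg z` -/
  | add (x y z : ℕ)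
  /-- `reg x := reg y - reg z`, truncated at `0` -/
  | sub (x y z : ℕ)
  /-- `reg x := arr a (reg y)` -/
  | load (x a y : ℕ)
  /-- `arr a (reg x) := reg y` -/
  | store (a x y : ℕ)
  /-- `wreg x := 0` -/
  | wzero (x : ℕ)
  /-- `wreg x := wreg y` -/
  | wcopy (x y : ℕ)
  /-- `wreg x := wreg y + wreg z` -/
  | wadd (x y z : ℕ)
  /-- `wreg x := wreg y - wreg z` -/
  | wsub (x y z : ℕ)
  /-- `wreg x := warr a (reg y)` -/
  | wload (x a y : ℕ)
  /-- `warr a (reg x) := wreg y` -/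
  | wstore (a x y : ℕ)

/-- The effect of an elementary instruction. -/
def Instr.exec : Instr → State → State
  | const x c, s => { s with reg := Function.update s.reg x c }
  | copy x y, s => { s with reg := Function.update s.reg x (s.reg y) }
  | add x y z, s => { s with reg := Function.update s.reg x (s.reg y + s.reg z) }
  | sub x y z, s => { s with reg := Function.update s.reg x (s.reg y - s.reg z) }
  | load x a y, s => { s with reg := Function.update s.reg x (s.arr a (s.reg y)) }
  | store a x y, s =>
      { s with arr := Function.update s.arr a (Function.update (s.arr a) (s.reg x) (s.reg y)) }
  | wzero x, s => { s with wreg := Function.update s.wreg x 0 }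
  | wcopy x y, s => { s with wreg := Function.update s.wreg x (s.wreg y) }
  | wadd x y z, s => { s with wreg := Function.update s.wreg x (s.wreg y + s.wreg z) }
  | wsub x y z, s => { s with wreg := Function.update s.wreg x (s.wreg y - s.wreg z) }
  | wload x a y, s => { s with wreg := Function.update s.wreg x (s.warr a (s.reg y)) }
  | wstore a x y, s =>
      { s with warr := Function.update s.warr a (Function.update (s.warr a) (s.reg x) (s.wreg y)) }

/-- Programs. -/
inductive Cmd where
  | instr (i : Instr)
  | seq (p q : Cmd)
  | cond (b : Test) (p q : Cmd)
  | loop (b : Test) (p : Cmd)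

/-- `Runs p s t s'`: started in state `s`, the program `p` halts after exactly `t` steps in state
`s'`. One step is charged for each elementary instruction and each evaluated test;
`loop b p` is the loop "while `b` do `p`". -/
inductive Runs : Cmd → State → ℕ → State → Prop where
  | instr (i : Instr) (s : State) : Runs (Cmd.instr i) s 1 (i.exec s)
  | seq {p q : Cmd} {s s₁ s₂ : State} {t₁ t₂ : ℕ} :
      Runs p s t₁ s₁ → Runs q s₁ t₂ s₂ → Runs (Cmd.seq p q) s (t₁ + t₂) s₂
  | condTrue {b : Test} {p q : Cmd} {s s₁ : State} {t : ℕ} :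
      b.Holds s → Runs p s t s₁ → Runs (Cmd.cond b p q) s (t + 1) s₁
  | condFalse {b : Test} {p q : Cmd} {s s₁ : State} {t : ℕ} :
      ¬ b.Holds s → Runs q s t s₁ → Runs (Cmd.cond b p q) s (t + 1) s₁
  | loopTrue {b : Test} {p : Cmd} {s s₁ s₂ : State} {t₁ t₂ : ℕ} :
      b.Holds s → Runs p s t₁ s₁ → Runs (Cmd.loop b p) s₁ t₂ s₂ →
        Runs (Cmd.loop b p) s (t₁ + t₂ + 1) s₂
  | loopFalse {b : Test} {p : Cmd} {s : State} :
      ¬ b.Holds s → Runs (Cmd.loop b p) s 1 s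

/-! ### The local search problems

Edge weights are given by a function on all unordered pairs, of which only the values on edges of
the graph are ever used. -/

/-- The total weight `ω(F)` of a set `F` of edges. -/
noncomputable def totalWeight {n : ℕ} (ω : Sym2 (Fin n) → ℚ) (F : Set (Sym2 (Fin n))) : ℚ :=
  open scoped Classical in ∑ e with e ∈ F, ω e

/-- The set `E(A, B)` of edges with one endpoint in `A` and the other in `B`. -/
def edgesBetween {n : ℕ} (G : SimpleGraph (Fin n)) (A B : Finset (Fin n)) :
    Set (Sym2 (Fin n)) :=
  {e ∈ G.edgeSet | ∃ u ∈ A, ∃ v ∈ B, e = s(u, v)}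

/-- The set `E(χ)` of properly colored edges. -/
def properEdges {n c : ℕ} (G : SimpleGraph (Fin n)) (χ : Fin n → Fin c) :
    Set (Sym2 (Fin n)) :=
  {e ∈ G.edgeSet | ∃ u v, e = s(u, v) ∧ χ u ≠ χ v}

/-- The flip `D_flip(χ, χ')` between two colorings. -/
def flip {n c : ℕ} (χ χ' : Fin n → Fin c) : Finset (Fin n) :=
  {v | χ v ≠ χ' v}

/-- `S` is an improving `k`-flip for the partition `(A, B)`. -/
def IsImprovingFlip {n : ℕ} (G : SimpleGraph (Fin n)) (ω : Sym2 (Fin n) → ℚ)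
    (A B : Finset (Fin n)) (k : ℕ) (S : Finset (Fin n)) : Prop :=
  S.card ≤ k ∧
    totalWeight ω (edgesBetween G A B) <
      totalWeight ω (edgesBetween G (symmDiff A S) (symmDiff B S))

/-- The coloring `χ'` is an improving `k`-neighbor of the coloring `χ`. -/
def IsImprovingNeighbor {n c : ℕ} (G : SimpleGraph (Fin n)) (ω : Sym2 (Fin n) → ℚ)
    (χ : Fin n → Fin c) (k : ℕ) (χ' : Fin n → Fin c) : Prop :=
  (flip χ χ').card ≤ k ∧
    totalWeight ω (properEdges G χ) < totalWeight ω (properEdges G χ')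

/-! ### Input and output conventions -/

/-- An adjacency-list representation of `G`: for each vertex its neighbors, in any order. -/
structure AdjLists {n : ℕ} (G : SimpleGraph (Fin n)) where
  /-- the list of neighbors of each vertex -/
  nbrs : Fin n → List (Fin n)
  nodup : ∀ v, (nbrs v).Nodup
  mem_iff : ∀ v w, w ∈ nbrs v ↔ G.Adj v w

/-- The input state. Register `0` holds `n` and register `1` holds `k`. The adjacency lists are
stored consecutively in array `1`, with the corresponding edge weights in rational array `0`; cell
`v ≤ n` of array `0` holds the position at which the list of `v` starts (and that of `v - 1` ends).
Array `2` holds a label for each vertex. Everything else is `0`. -/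
def inputState {n : ℕ} {G : SimpleGraph (Fin n)} (L : AdjLists G) (ω : Sym2 (Fin n) → ℚ)
    (label : Fin n → ℕ) (k : ℕ) : State where
  reg x := if x = 0 then n else if x = 1 then k else 0
  arr a i :=
    if a = 0 then
      if i ≤ n then ((List.ofFn L.nbrs).take i).flatten.length else 0
    else if a = 1 then
      ((List.ofFn L.nbrs).flatten.map Fin.val).getD i 0
    else if a = 2 then
      if h : i < n then label ⟨i, h⟩ else 0
    else 0
  wreg _ := 0
  warr a i :=
    if a = 0 then
      (List.ofFn fun v => (L.nbrs v).map fun w => ω s(v, w)).flatten.getD i 0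
    else 0

/-- The input state for `LS Max Cut`; vertices in `A` are labeled `0`, those in `B` are
labeled `1`. -/
def cutInput {n : ℕ} {G : SimpleGraph (Fin n)} (L : AdjLists G) (ω : Sym2 (Fin n) → ℚ)
    (_A B : Finset (Fin n)) (k : ℕ) : State :=
  inputState L ω (fun v => if v ∈ B then 1 else 0) k

/-- The input state for `LS Max c-Cut`; each vertex is labeled by its color. -/
def coloringInput {n c : ℕ} {G : SimpleGraph (Fin n)} (L : AdjLists G) (ω : Sym2 (Fin n) → ℚ)
    (χ : Fin n → Fin c) (k : ℕ) : State :=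
  inputState L ω (fun v => (χ v : ℕ)) k

/-- The final state is a correct answer for `LS Max Cut`: either register `0` holds `1` and array
`3` holds the characteristic vector of an improving `k`-flip, or register `0` holds `0` and there
is no improving `k`-flip. -/
def CutAnswer {n : ℕ} (G : SimpleGraph (Fin n)) (ω : Sym2 (Fin n) → ℚ)
    (A B : Finset (Fin n)) (k : ℕ) (s : State) : Prop :=
  (s.reg 0 = 1 ∧ ∃ S : Finset (Fin n), IsImprovingFlip G ω A B k S ∧
      ∀ v : Fin n, s.arr 3 v = if v ∈ S then 1 else 0) ∨
    (s.reg 0 = 0 ∧ ¬ ∃ S : Finset (Fin n), IsImprovingFlip G ω A B k S)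

/-- The final state is a correct answer for `LS Max c-Cut`: either register `0` holds `1` and array
`3` holds an improving `k`-neighbor of `χ`, or register `0` holds `0` and there is none. -/
def ColoringAnswer {n c : ℕ} (G : SimpleGraph (Fin n)) (ω : Sym2 (Fin n) → ℚ)
    (χ : Fin n → Fin c) (k : ℕ) (s : State) : Prop :=
  (s.reg 0 = 1 ∧ ∃ χ' : Fin n → Fin c, IsImprovingNeighbor G ω χ k χ' ∧
      ∀ v : Fin n, s.arr 3 v = (χ' v : ℕ)) ∨
    (s.reg 0 = 0 ∧ ¬ ∃ χ' : Fin n → Fin c, IsImprovingNeighbor G ω χ k χ')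

end LocalCut

/-! Let an improving coloring `ψ` differ from `χ` on as few vertices as possible. If the changed
vertices fall into two parts with no edge between them, the gains of the parts add up
(`totalWeight_split`). By minimality no proper part improves alone, so recoloring only the part
connected to a chosen changed vertex must already improve. It therefore suffices to search for
recolorings that grow from a root along edges.

Such a recoloring is encoded by a digit sequence. A queue starts at the root. Each vertex taken from
it that still has its old color reads one digit: `0` leaves it alone, while `a ≠ 0` adds `a` to its
color modulo `c` and queues its neighbors. Write `D = Δ - 1`. The root costs one digit, its
neighbors at most `D + 1`, and every further recolored vertex adds at most `D` unchanged entries,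
since one of its neighbors has changed before. Thus `k * D + 2` digits suffice, with at most `k` of
them nonzero (`exists_digits`, `exists_code`). Conversely, a code with at most `k` nonzero digits
changes at most `k` vertices (`Explore.card_flip_le`), so every improvement found is a valid answer.

A generating-function estimate bounds the number of codes of length `m` by `((c - 1) * m / k) ^ k *
e ^ k` (`card_remaining_le`). For `m = k * D + 2` this is at most `e ^ 2 * ((c - 1) * e) ^ k * D ^
k`. Running a code, undoing it and computing its colexicographic successor take `O(k * D)` steps
(`exec_explore`, `exec_undo`, `exec_nextCode`). Summing over `n` roots gives the bound, with a
factor `k` to spare (`searchTime_le`).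

Max Cut is the case `c = 2`, with a partition read as a 2-coloring. Machine time is tracked by
credits: a program starts with a supply and the postcondition may speak of what is left, so one
invariant proves correctness, termination and the time bound together. -/

namespace LocalCut

/-! ### Reasoning about programs with time credits -/

/-- Started in `s` with `τ` time credits, `p` halts with `τ'` credits left in a state `s'`
such that `Q τ' s'`. -/
def Exec (p : Cmd) (s : State) (τ : ℕ) (Q : ℕ → State → Prop) : Prop :=
  ∃ t s' τ', Runs p s t s' ∧ t + τ' ≤ τ ∧ Q τ' s'

/-- The sequence of the given instructions. -/
def block : List Instr → Cmd
  | [] => Cmd.instr (Instr.copy 22 22)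
  | i :: l => Cmd.seq (Cmd.instr i) (block l)

/-- The combined effect of a list of instructions. -/
def execAll (l : List Instr) (s : State) : State :=
  l.foldl (fun s i => i.exec s) s

/-- The component of the memory an instruction writes to. -/
def Instr.dest : Instr → ℕ × ℕ
  | const x _ => (0, x)
  | copy x _ => (0, x)
  | add x _ _ => (0, x)
  | sub x _ _ => (0, x)
  | load x _ _ => (0, x)
  | store a _ _ => (1, a)
  | wzero x => (2, x)
  | wcopy x _ => (2, x)
  | wadd x _ _ => (2, x)
  | wsub x _ _ => (2, x)
  | wload x _ _ => (2, x)
  | wstore a _ _ => (3, a)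

/-- The program does not write to the given component of the memory. -/
def Cmd.keeps (d : ℕ × ℕ) : Cmd → Bool
  | instr i => i.dest != d
  | seq p q => p.keeps d && q.keeps d
  | cond _ p q => p.keeps d && q.keeps d
  | loop _ p => p.keeps d

/-- `s'` differs from `s` only in components that `p` writes to. -/
structure Frame (p : Cmd) (s s' : State) : Prop where
  reg : ∀ x, p.keeps (0, x) = true → s'.reg x = s.reg x
  arr : ∀ x, p.keeps (1, x) = true → s'.arr x = s.arr x
  wreg : ∀ x, p.keeps (2, x) = true → s'.wreg x = s.wreg x
  warr : ∀ x, p.keeps (3, x) = true → s'.warr x = s.warr x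

theorem Frame.refl (p : Cmd) (s : State) : Frame p s s :=
  ⟨fun _ _ => rfl, fun _ _ => rfl, fun _ _ => rfl, fun _ _ => rfl⟩

theorem Frame.trans {p q r : Cmd} {s s₁ s₂ : State} (h₁ : Frame p s s₁) (h₂ : Frame q s₁ s₂)
    (hr : ∀ d, r.keeps d = true → p.keeps d = true ∧ q.keeps d = true) : Frame r s s₂ :=
  ⟨fun x h => (h₂.reg x (hr _ h).2).trans (h₁.reg x (hr _ h).1),
    fun x h => (h₂.arr x (hr _ h).2).trans (h₁.arr x (hr _ h).1),
    fun x h => (h₂.wreg x (hr _ h).2).trans (h₁.wreg x (hr _ h).1),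
    fun x h => (h₂.warr x (hr _ h).2).trans (h₁.warr x (hr _ h).1)⟩

theorem frame_instr (i : Instr) (s : State) : Frame (Cmd.instr i) s (i.exec s) := by
  constructor <;> intro x hx <;> cases i <;>
    first
    | rfl
    | exact Function.update_of_ne (fun h => by simp [Cmd.keeps, Instr.dest, h] at hx) _ _

/-- Whether a concrete program writes to a component is a Boolean computation, so this lemma carries
unaffected values across whole subprograms by `rfl`. -/
theorem Runs.frame {p : Cmd} {s s' : State} {t : ℕ} (h : Runs p s t s') : Frame p s s' := by
  induction h with
  | instr i s => exact frame_instr i s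
  | seq _ _ h₁ h₂ => exact h₁.trans h₂ fun d h => by simpa [Cmd.keeps] using h
  | condTrue _ _ h₁ => exact h₁.trans (Frame.refl _ _) fun d h => by simpa [Cmd.keeps] using h
  | condFalse _ _ h₁ =>
    exact (Frame.refl _ _).trans h₁ fun d h => by simpa [Cmd.keeps] using h
  | loopTrue _ _ _ h₁ h₂ => exact h₁.trans h₂ fun d h => by simpa [Cmd.keeps] using h
  | loopFalse => exact Frame.refl _ _

section Rules

variable {p q : Cmd} {b : Test} {s : State} {τ τ₂ : ℕ} {Q Q' : ℕ → State → Prop}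

theorem Exec.mono (h : Exec p s τ Q) (hτ : τ ≤ τ₂)
    (hQ : ∀ τ' s', Frame p s s' → Q τ' s' → Q' τ' s') : Exec p s τ₂ Q' := by
  obtain ⟨t, s', τ', hr, ht, hq⟩ := h
  exact ⟨t, s', τ', hr, ht.trans hτ, hQ _ _ hr.frame hq⟩

/-- Credits that are not needed by `p` are left over. -/
theorem Exec.save {Q : State → Prop} (T : ℕ) (h : Exec p s T fun _ => Q) (hτ : T ≤ τ)
    (hQ : ∀ τ' s', τ ≤ τ' + T → Frame p s s' → Q s' → Q' τ' s') : Exec p s τ Q' := by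
  obtain ⟨t, s', τ', hr, ht, hq⟩ := h
  exact ⟨t, s', τ - t, hr, by omega, hQ _ _ (by omega) hr.frame hq⟩

theorem Exec.seq (h : Exec p s τ fun τ₁ s₁ => Exec q s₁ τ₁ Q) : Exec (p.seq q) s τ Q := by
  obtain ⟨t₁, s₁, τ₁, hr₁, ht₁, t₂, s₂, τ₂, hr₂, ht₂, hq⟩ := h
  exact ⟨_, s₂, τ₂, Runs.seq hr₁ hr₂, by omega, hq⟩

theorem Exec.cond (hτ : 1 ≤ τ) (h₁ : b.Holds s → Exec p s (τ - 1) Q)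
    (h₂ : ¬ b.Holds s → Exec q s (τ - 1) Q) : Exec (Cmd.cond b p q) s τ Q := by
  by_cases hb : b.Holds s
  · obtain ⟨t, s', τ', hr, ht, hq⟩ := h₁ hb
    exact ⟨_, s', τ', Runs.condTrue hb hr, by omega, hq⟩
  · obtain ⟨t, s', τ', hr, ht, hq⟩ := h₂ hb
    exact ⟨_, s', τ', Runs.condFalse hb hr, by omega, hq⟩

/-- The invariant mentions the credits left. Every test consumes one, so the credits strictly
decrease and strong induction on them yields termination without a separate measure. -/
theorem Exec.loop (I : ℕ → State → Prop)
    (h : ∀ τ s', Frame (Cmd.loop b p) s s' → I τ s' → 1 ≤ τ ∧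
      (b.Holds s' → Exec p s' (τ - 1) I) ∧ (¬ b.Holds s' → Q (τ - 1) s'))
    (h₀ : I τ s) : Exec (Cmd.loop b p) s τ Q := by
  suffices H : ∀ τ s', Frame (Cmd.loop b p) s s' → I τ s' → Exec (Cmd.loop b p) s' τ Q from
    H τ s (Frame.refl _ _) h₀
  intro τ
  induction τ using Nat.strong_induction_on with
  | _ τ ih =>
    intro s' hf hI
    obtain ⟨hτ, h₁, h₂⟩ := h τ s' hf hI
    by_cases hb : b.Holds s'
    · obtain ⟨t, s₁, τ₁, hr, ht, hI₁⟩ := h₁ hb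
      obtain ⟨t₂, s₂, τ₂, hr₂, ht₂, hq⟩ := ih τ₁ (by omega) s₁
        (hf.trans hr.frame fun d h => by simpa [Cmd.keeps] using h) hI₁
      exact ⟨_, s₂, τ₂, Runs.loopTrue hb hr hr₂, by omega, hq⟩
    · exact ⟨1, s', τ - 1, Runs.loopFalse hb, by omega, h₂ hb⟩

/-- The additional step is the self-copy that ends every block and leaves the state unchanged. -/
theorem runs_block (l : List Instr) (s : State) :
    Runs (block l) s (l.length + 1) (execAll l s) := by
  induction l generalizing s with
  | nil =>
    have h := Runs.instr (Instr.copy 22 22) s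
    have hs : (Instr.copy 22 22).exec s = s := by ext <;> simp [Instr.exec]
    rw [hs] at h
    exact h
  | cons i l ih =>
    have h := Runs.seq (Runs.instr i s) (ih (i.exec s))
    rw [add_comm] at h
    exact h

theorem Exec.block {l : List Instr} (N : ℕ) (hN : l.length + 1 = N) (hτ : N ≤ τ)
    (h : ∀ s', s' = execAll l s → Frame (block l) s s' → Q (τ - N) s') :
    Exec (block l) s τ Q :=
  ⟨_, _, _, runs_block l s, by omega, h _ rfl (runs_block l s).frame⟩

end Rules

/-! ### The program

Registers: `0`: number `n` of vertices, `1`: `k`, `2`: one, `3`: zero, `4`: number `c` of colors,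
`5`: code length `m`, `6`: root, `7`: whether codes are left, `8`: weight of the code, `9`: answer,
`10`, `11`: head and tail of the queue, `12`: position in the code.
Rational registers: `0`: gain, `1`: zero.
Arrays: `3`: current coloring, `4`: queue, `5`: code. -/

/-- Computes the maximum degree into register `13`. -/
def maxDegreeLoop : Cmd :=
  Cmd.loop (Test.lt 14 0) (Cmd.seq
    (block [.load 15 0 14, .add 14 14 2, .load 16 0 14, .sub 16 16 15])
    (Cmd.cond (Test.lt 13 16) (block [.copy 13 16]) (block [])))

/-- Adds register `13` to register `5`, `k` times. -/
def lengthLoop : Cmd :=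
  Cmd.loop (Test.lt 14 1) (block [.add 5 5 13, .add 14 14 2])

/-- Copies the labels to array `3`. -/
def copyLoop : Cmd :=
  Cmd.loop (Test.lt 14 0) (block [.load 15 2 14, .store 3 14 15, .add 14 14 2])

/-- Initialization for `c` colors. -/
def setup (c : ℕ) : Cmd :=
  Cmd.seq (block [.const 2 1, .const 4 c, .const 13 0, .const 14 0])
    (Cmd.seq maxDegreeLoop
      (Cmd.seq (block [.sub 13 13 2, .const 5 2, .const 14 0])
        (Cmd.seq lengthLoop (Cmd.seq (block [.const 14 0]) copyLoop))))

/-- Appends the neighbors of a vertex that changes its color from register `14` to register `17`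
to the queue and updates the gain; the adjacency list extends from register `18` to `19`. -/
def nbrLoop : Cmd :=
  Cmd.loop (Test.lt 18 19) (Cmd.seq
    (block [.load 20 1 18, .wload 2 0 18, .add 18 18 2, .store 4 11 20, .add 11 11 2, .load 21 3 20])
    (Cmd.cond (Test.eq 21 14) (block [.wadd 0 0 2])
      (Cmd.cond (Test.eq 21 17) (block [.wsub 0 0 2]) (block []))))

/-- Changes the color of the vertex in register `13`, which is in register `14`, by the digit in
register `16`. -/
def recolor : Cmd :=
  Cmd.seq (block [.add 17 14 16])
    (Cmd.seq (Cmd.cond (Test.lt 17 4) (block []) (block [.sub 17 17 4]))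
      (Cmd.seq (block [.load 18 0 13, .add 19 13 2, .load 19 0 19])
        (Cmd.seq nbrLoop (block [.store 3 13 17]))))

/-- Processes the vertex at the head of the queue. -/
def visit : Cmd :=
  Cmd.seq (block [.load 13 4 10, .add 10 10 2, .load 14 3 13, .load 15 2 13])
    (Cmd.cond (Test.eq 14 15)
      (Cmd.seq (block [.load 16 5 12, .add 12 12 2])
        (Cmd.cond (Test.lt 3 16) recolor (block [])))
      (block []))

/-- Recolors the vertices reached from the root as the code prescribes. -/
def explore : Cmd :=
  Cmd.seq (block [.const 10 0, .const 11 1, .store 4 3 6, .const 12 0, .wzero 0])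
    (Cmd.loop (Test.lt 10 11) visit)

/-- Restores the original coloring of the vertices in the queue. -/
def undo : Cmd :=
  Cmd.seq (block [.const 14 0])
    (Cmd.loop (Test.lt 14 11)
      (block [.load 13 4 14, .load 15 2 13, .store 3 13 15, .add 14 14 2]))

/-- Proceeds to the next code and sets register `7` to `0` if there is none. -/
def nextCode : Cmd :=
  Cmd.seq (block [.const 14 0, .const 16 1])
    (Cmd.loop (Test.eq 16 2)
      (Cmd.cond (Test.lt 14 5)
        (Cmd.seq (block [.load 15 5 14])
          (Cmd.cond (Test.eq 15 3)
            (Cmd.cond (Test.lt 8 1)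
              (block [.store 5 14 2, .add 8 8 2, .const 16 0])
              (block [.add 14 14 2]))
            (Cmd.seq (block [.add 15 15 2])
              (Cmd.cond (Test.lt 15 4)
                (block [.store 5 14 15, .const 16 0])
                (block [.store 5 14 3, .sub 8 8 2, .add 14 14 2])))))
        (block [.const 16 0, .const 7 0])))

/-- Tries the current code and proceeds to the next one. -/
def tryCode : Cmd :=
  Cmd.seq explore
    (Cmd.cond (Test.wlt 1 0)
      (block [.const 9 1, .const 7 0, .copy 6 0])
      (Cmd.seq undo nextCode))

/-- Tries all codes for all roots. -/
def search : Cmd :=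
  Cmd.loop (Test.lt 6 0)
    (Cmd.seq (block [.const 7 1])
      (Cmd.seq (Cmd.loop (Test.eq 7 2) tryCode) (block [.add 6 6 2])))

/-- The local search for `c` colors; the answer is in register `9`. -/
def localSearch (c : ℕ) : Cmd :=
  Cmd.seq (setup c) search

/-- The program for `LS Max c-Cut`. -/
def coloringProgram (c : ℕ) : Cmd :=
  Cmd.seq (localSearch c) (block [.copy 0 9])

/-- Marks in array `3` the vertices on which it differs from array `2`. -/
def markLoop : Cmd :=
  Cmd.loop (Test.lt 14 0)
    (Cmd.seq (block [.load 15 2 14, .load 16 3 14])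
      (Cmd.seq (Cmd.cond (Test.eq 15 16) (block [.store 3 14 3]) (block [.store 3 14 2]))
        (block [.add 14 14 2])))

/-- The program for `LS Max Cut`. -/
def cutProgram : Cmd :=
  Cmd.seq (localSearch 2)
    (Cmd.seq (block [.const 14 0]) (Cmd.seq markLoop (block [.copy 0 9])))

/-! ### Weights of colorings -/

section Weights

variable {n c : ℕ} {G : SimpleGraph (Fin n)}

theorem mem_properEdges {χ : Fin n → Fin c} {u v : Fin n} :
    s(u, v) ∈ properEdges G χ ↔ G.Adj u v ∧ χ u ≠ χ v := by
  simp only [properEdges, Set.mem_ofPred_eq, SimpleGraph.mem_edgeSet, Sym2.eq_iff]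
  refine and_congr_right fun _ => ⟨?_, fun h => ⟨u, v, by simp, h⟩⟩
  rintro ⟨a, b, ⟨rfl, rfl⟩ | ⟨rfl, rfl⟩, h⟩
  exacts [h, h.symm]

open scoped Classical in
theorem totalWeight_eq (ω : Sym2 (Fin n) → ℚ) (F : Set (Sym2 (Fin n))) :
    totalWeight ω F = ∑ e, if e ∈ F then ω e else 0 := by
  rw [totalWeight, Finset.sum_filter]

/-- The change of the weight when `w` gets color `z` instead of `x`, summed over the neighbors. -/
def recolorGain (ω : Sym2 (Fin n) → ℚ) (cur : Fin n → Fin c) (w : Fin n) (x z : Fin c)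
    (l : List (Fin n)) : ℚ :=
  (l.map fun u => if cur u = x then ω s(w, u) else if cur u = z then - ω s(w, u) else 0).sum

/-- Only edges at `w` can change status. An edge to a neighbor of the old color of `w` becomes cut,
one to a neighbor of color `z` ceases to be cut, and all others keep their status. This allows the
gain to be maintained in time proportional to the degree. -/
theorem totalWeight_update (L : AdjLists G) (ω : Sym2 (Fin n) → ℚ) (cur : Fin n → Fin c)
    (w : Fin n) (z : Fin c) (hz : z ≠ cur w) :
    totalWeight ω (properEdges G (Function.update cur w z)) =
      totalWeight ω (properEdges G cur) + recolorGain ω cur w (cur w) z (L.nbrs w) := by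
  classical
  rw [← sub_eq_iff_eq_add', totalWeight_eq, totalWeight_eq, ← Finset.sum_sub_distrib, recolorGain,
    ← List.sum_toFinset _ (L.nodup w)]
  have hinj : Set.InjOn (fun u => s(w, u)) ((L.nbrs w).toFinset : Set (Fin n)) :=
    fun a _ b _ h => Sym2.congr_right.1 h
  have hne : ∀ u, G.Adj w u → u ≠ w := fun u h => h.ne'
  rw [← Finset.sum_subset (Finset.subset_univ ((L.nbrs w).toFinset.image fun u => s(w, u))),
    Finset.sum_image hinj]
  · refine Finset.sum_congr rfl fun u hu => ?_
    have hu' : G.Adj w u := by simpa [L.mem_iff] using hu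
    simp only [mem_properEdges, hu', true_and, Function.update_self,
      Function.update_of_ne (hne u hu')]
    by_cases h₁ : cur u = cur w
    · simp [h₁, hz]
    · by_cases h₂ : cur u = z
      · simp [h₂, Ne.symm hz, hz]
      · simp [h₁, h₂, Ne.symm h₁, Ne.symm h₂]
  · intro e _ he
    induction e with
    | _ a b =>
      have ha : G.Adj a b → a ≠ w := by
        rintro h rfl
        exact he (Finset.mem_image.2 ⟨b, by simpa [L.mem_iff] using h, rfl⟩)
      have hb : G.Adj a b → b ≠ w := by
        rintro h rfl
        exact he (Finset.mem_image.2 ⟨a, by simpa [L.mem_iff] using h.symm, Sym2.eq_swap⟩)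
      by_cases h : G.Adj a b
      · simp [mem_properEdges, Function.update_of_ne (ha h), Function.update_of_ne (hb h)]
      · simp [mem_properEdges, h]

/-- If no edge joins two parts of a change, then its effect is the sum of the effects of its
parts. -/
theorem totalWeight_split (ω : Sym2 (Fin n) → ℚ) (χ ψ r r' : Fin n → Fin c)
    (hr : ∀ u, r u = χ u ∨ r u = ψ u)
    (hclosed : ∀ u x, r u ≠ χ u → G.Adj u x → ψ x ≠ χ x → r x ≠ χ x)
    (hr' : ∀ u, r' u = if r u = χ u then ψ u else χ u) :
    totalWeight ω (properEdges G r) + totalWeight ω (properEdges G r') =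
      totalWeight ω (properEdges G χ) + totalWeight ω (properEdges G ψ) := by
  classical
  simp only [totalWeight_eq, ← Finset.sum_add_distrib]
  refine Finset.sum_congr rfl fun e _ => ?_
  induction e with
  | _ a b =>
    simp only [mem_properEdges]
    by_cases hab : G.Adj a b
    · have h₁ := hclosed a b
      have h₂ := hclosed b a
      have ha := hr' a
      have hb := hr' b
      have ha' := hr a
      have hb' := hr b
      simp only [hab, hab.symm, true_and, forall_true_left] at h₁ h₂ ⊢
      -- If an end of the edge lies in the part changed by `r`, the other end lies in it too or is
      -- unchanged by `ψ`; so `r` agrees with `ψ` on the edge and `r'` with `χ`. Otherwise `r`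
      -- agrees with `χ` on it and `r'` with `ψ`.
      by_cases ra : r a = χ a <;> by_cases rb : r b = χ b <;> simp only [ra, rb, if_true, if_false,
        not_true, not_false_iff, forall_true_left, ne_eq, imp_false, false_implies, not_not,
        false_or] at ha hb h₁ h₂ ha' hb' <;> simp only [ha, hb, ra, rb, h₁, h₂, ha', hb'] <;> ring
    · simp [hab]

end Weights

/-! ### Codes and the recolorings they prescribe -/

/-- The number of nonzero digits among the first `m`. -/
def weight (m : ℕ) (d : ℕ → ℕ) : ℕ := ∑ i ∈ Finset.range m, if d i = 0 then 0 else 1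

/-- Dropping the first digit moves the window by one place; the digit that enters is `d m`, hence
the hypothesis. -/
theorem weight_shift {m : ℕ} {d : ℕ → ℕ} (h : d m = 0) :
    weight m d = (if d 0 = 0 then 0 else 1) + weight m fun i => d (i + 1) := by
  have h₁ := Finset.sum_range_succ (fun i => if d i = 0 then 0 else 1) m
  have h₂ := Finset.sum_range_succ' (fun i => if d i = 0 then 0 else 1) m
  simp only [h, if_true] at h₁
  simp only [weight]
  omega

/-- The digit sequence with first digit `a` and remaining digits `d`. -/
def consDigit (a : ℕ) (d : ℕ → ℕ) : ℕ → ℕ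
  | 0 => a
  | i + 1 => d i

/-- A code with digits less than `c`, length `m` and at most `k` nonzero digits. -/
structure IsCode (c m k : ℕ) (d : ℕ → ℕ) : Prop where
  lt : ∀ i, d i < c
  eq_zero : ∀ i, m ≤ i → d i = 0
  weight_le : weight m d ≤ k

section Explore

variable {n c : ℕ} {G : SimpleGraph (Fin n)}

/-- `Explore L χ d q cur r`: processing the queue `q` of vertices with the digits `d` turns the
coloring `cur` into `r`. A vertex that already changed its color is skipped; otherwise a digit is
read, and if it is nonzero, it is added to the color and the neighbors are appended to the queue. -/
inductive Explore (L : AdjLists G) (χ : Fin n → Fin c) :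
    (ℕ → ℕ) → List (Fin n) → (Fin n → Fin c) → (Fin n → Fin c) → Prop
  | nil (d : ℕ → ℕ) (cur : Fin n → Fin c) : Explore L χ d [] cur cur
  | skip {d q cur r w} : cur w ≠ χ w → Explore L χ d q cur r → Explore L χ d (w :: q) cur r
  | reject {d q cur r w} : cur w = χ w → d 0 = 0 → Explore L χ (fun i => d (i + 1)) q cur r →
      Explore L χ d (w :: q) cur r
  | take {d q cur r w} {z : Fin c} : cur w = χ w → d 0 ≠ 0 →
      ((z : ℕ) = χ w + d 0 ∨ (z : ℕ) + c = χ w + d 0) →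
      Explore L χ (fun i => d (i + 1)) (q ++ L.nbrs w) (Function.update cur w z) r →
      Explore L χ d (w :: q) cur r

variable {L : AdjLists G} {χ : Fin n → Fin c}

/-- Exploration is deterministic, because the new color is determined by the old one and the digit:
both candidates are below `c`. Hence one run of the program settles all results of a code. -/
theorem Explore.unique {d : ℕ → ℕ} {q : List (Fin n)} {cur r r' : Fin n → Fin c}
    (h : Explore L χ d q cur r) (h' : Explore L χ d q cur r') : r = r' := by
  induction h with
  | nil => cases h'; rfl
  | skip h₁ _ ih => cases h' <;> first | exact ih ‹_› | contradiction
  | reject h₁ h₂ _ ih => cases h' <;> first | exact ih ‹_› | contradiction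
  | @take d q cur r w z h₁ h₂ h₃ _ ih =>
    cases h' with
    | skip => contradiction
    | reject => contradiction
    | @take _ _ _ _ _ z' _ _ h₃' h' =>
      have hz : z' = z := Fin.ext (by have := z.2; have := z'.2; omega)
      subst hz
      exact ih h'

theorem card_flip_update_le (χ cur : Fin n → Fin c) (w : Fin n) (z : Fin c) :
    (flip χ (Function.update cur w z)).card ≤ (flip χ cur).card + 1 := by
  refine (Finset.card_le_card (t := insert w (flip χ cur)) fun u hu => ?_).trans
    (Finset.card_insert_le _ _)
  by_cases h : u = w
  · simp [h]
  · simpa [flip, h] using hu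

/-- Every change of a color uses up a nonzero digit. -/
theorem Explore.card_flip_le {d : ℕ → ℕ} {q : List (Fin n)} {cur r : Fin n → Fin c}
    (h : Explore L χ d q cur r) (m : ℕ) (hd : ∀ i, m ≤ i → d i = 0) :
    (flip χ r).card ≤ (flip χ cur).card + weight m d := by
  induction h with
  | nil => omega
  | skip _ _ ih => exact ih hd
  | reject _ h₂ _ ih =>
    rw [weight_shift (hd m le_rfl)]
    have := ih fun i hi => hd _ (by omega)
    omega
  | @take d q cur r w z _ h₂ _ _ ih =>
    rw [weight_shift (hd m le_rfl), if_neg h₂]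
    have := ih fun i hi => hd _ (by omega)
    have := card_flip_update_le χ cur w z
    omega

/-- The digit that turns color `x` into color `z`. -/
theorem exists_digit {x z : Fin c} (h : z ≠ x) :
    ∃ a, a ≠ 0 ∧ a < c ∧ ((z : ℕ) = x + a ∨ (z : ℕ) + c = x + a) := by
  have hx := x.2
  have hz := z.2
  have hne : (z : ℕ) ≠ x := fun h' => h (Fin.ext h')
  by_cases hlt : (x : ℕ) < z
  · exact ⟨z - x, by omega, by omega, by omega⟩
  · exact ⟨z + c - x, by omega, by omega, by omega⟩

theorem weight_consDigit_le (m a : ℕ) (d : ℕ → ℕ) :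
    weight m (consDigit a d) ≤ (if a = 0 then 0 else 1) + weight m d := by
  have h₁ : weight (m + 1) (consDigit a d) = weight m (consDigit a d) +
      if consDigit a d m = 0 then 0 else 1 := Finset.sum_range_succ _ m
  have h₂ : weight (m + 1) (consDigit a d) = weight m d + if a = 0 then 0 else 1 :=
    Finset.sum_range_succ' _ m
  omega

/-- Digits that recolor, as `ψ` prescribes, all vertices that can be reached from the queue within
the set of vertices where `ψ` differs from `χ`. -/
theorem exists_digits (hc : 0 < c) (ψ : Fin n → Fin c) (D : ℕ)
    (hD : ∀ v, (L.nbrs v).length ≤ D + 1) (N : ℕ) :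
    ∀ (q : List (Fin n)) (cur : Fin n → Fin c), (flip cur ψ).card = N →
    (∀ u, cur u = χ u ∨ cur u = ψ u) →
    (∀ u ∈ q, ∃ x, G.Adj u x ∧ cur x ≠ χ x) →
    (∀ u x, cur u ≠ χ u → G.Adj u x → ψ x ≠ χ x → cur x ≠ χ x ∨ x ∈ q) →
    ∃ d r, Explore L χ d q cur r ∧ (∀ i, d i < c) ∧
      (∀ i, (q.filter fun u => cur u = χ u).length + D * N ≤ i → d i = 0) ∧
      (∀ m, weight m d ≤ N) ∧ (∀ u, r u = χ u ∨ r u = ψ u) ∧ (∀ u, cur u ≠ χ u → r u ≠ χ u) ∧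
      (∀ u x, r u ≠ χ u → G.Adj u x → ψ x ≠ χ x → r x ≠ χ x) := by
  -- The outer induction is on the number of vertices still to be recolored, the inner one on the
  -- queue: skipping or rejecting shortens the queue, taking lowers `N`. The length bound counts one
  -- digit per unchanged queue entry, with multiplicity, plus `D` for each vertex yet to be taken.
  induction N using Nat.strong_induction_on with
  | _ N ihN =>
  intro q
  induction q with
  | nil =>
    intro cur _ hcur _ hclosed
    exact ⟨fun _ => 0, cur, .nil _ _, fun _ => hc, fun _ _ => rfl, fun m => by simp [weight], hcur,
      fun _ h => h, fun u x h₁ h₂ h₃ => (hclosed u x h₁ h₂ h₃).resolve_right (by simp)⟩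
  | cons w q ihq =>
    intro cur hN hcur hq hclosed
    by_cases hw : cur w = χ w
    · by_cases hψ : ψ w = χ w
      · obtain ⟨d, r, hE, hlt, h0, hwt, hr⟩ := ihq cur hN hcur (fun u hu => hq u (by simp [hu]))
          fun u x h₁ h₂ h₃ => by
            rcases hclosed u x h₁ h₂ h₃ with h | h
            · exact Or.inl h
            · rcases List.mem_cons.1 h with rfl | h
              · exact absurd hψ h₃
              · exact Or.inr h
        refine ⟨consDigit 0 d, r, .reject hw rfl hE, ?_, ?_, fun m => ?_, hr⟩
        · rintro (_ | i)
          exacts [hc, hlt i]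
        · rintro (_ | i) hi
          · rfl
          · refine h0 i ?_
            simp only [List.filter_cons, hw, decide_true, if_true, List.length_cons] at hi
            omega
        · have := weight_consDigit_le m 0 d
          have := hwt m
          simp at *
          omega
      · obtain ⟨a, ha, hac, haz⟩ := exists_digit hψ
        set cur' := Function.update cur w (ψ w) with hcur'
        have hself : cur' w = ψ w := by simp [hcur']
        have hoff : ∀ u, u ≠ w → cur' u = cur u := fun u hu => by simp [hcur', hu]
        have hflip : flip cur' ψ = (flip cur ψ).erase w := by
          ext u
          by_cases hu : u = w
          · simp [hu, flip, hself]
          · simp [hu, flip, hoff]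
        have hmem : w ∈ flip cur ψ := by simp [flip, hw, Ne.symm hψ]
        have hcard : (flip cur' ψ).card + 1 = N := by
          rw [hflip, Finset.card_erase_add_one hmem, hN]
        have hkeep : ∀ u, cur u ≠ χ u → cur' u ≠ χ u := fun u hu => by
          rw [hoff u (by rintro rfl; exact hu hw)]
          exact hu
        obtain ⟨d, r, hE, hlt, h0, hwt, hr, hr', hcl⟩ := ihN (flip cur' ψ).card (by omega)
          (q ++ L.nbrs w) cur' rfl
          (fun u => by
            by_cases hu : u = w
            · subst hu; exact Or.inr hself
            · rw [hoff u hu]; exact hcur u)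
          (fun u hu => by
            rcases List.mem_append.1 hu with hu | hu
            · obtain ⟨x, hx, hx'⟩ := hq u (by simp [hu])
              exact ⟨x, hx, hkeep x hx'⟩
            · exact ⟨w, ((L.mem_iff w u).1 hu).symm, by rw [hself]; exact hψ⟩)
          (fun u x h₁ h₂ h₃ => by
            by_cases hx : x = w
            · subst hx; exact Or.inl (by rw [hself]; exact hψ)
            by_cases hu : u = w
            · subst hu
              exact Or.inr (List.mem_append.2 (Or.inr ((L.mem_iff _ _).2 h₂)))
            · rw [hoff u hu] at h₁
              rcases hclosed u x h₁ h₂ h₃ with h | h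
              · exact Or.inl (hkeep x h)
              · exact Or.inr (List.mem_append.2 (Or.inl ((List.mem_cons.1 h).resolve_left hx))))
        refine ⟨consDigit a d, r, .take hw ha haz hE, ?_, ?_, fun m => ?_, hr,
          fun u hu => hr' u (hkeep u hu), hcl⟩
        · rintro (_ | i)
          exacts [hac, hlt i]
        · have hle₁ : (q.filter fun u => cur' u = χ u).length ≤
              (q.filter fun u => cur u = χ u).length := by
            rw [← List.countP_eq_length_filter, ← List.countP_eq_length_filter]
            refine List.countP_mono_left fun u _ hu => ?_
            by_contra h
            exact hkeep u (by simpa using h) (by simpa using hu)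
          -- The vertex `w` has a neighbor that has already changed. That neighbor will be skipped,
          -- so at most `D` of the at most `D + 1` new entries read a digit.
          have hle₂ : ((L.nbrs w).filter fun u => cur' u = χ u).length ≤ D := by
            obtain ⟨x, hx, hx'⟩ := hq w (by simp)
            have h₁ : ((L.nbrs w).filter fun u => cur' u = χ u).length < (L.nbrs w).length := by
              rw [List.length_filter_lt_length_iff_exists]
              exact ⟨x, (L.mem_iff _ _).2 hx, by simpa using hkeep x hx'⟩
            have := hD w
            omega
          rintro (_ | i) hi
          · simp only [List.filter_cons, hw, decide_true, if_true, List.length_cons] at hi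
            omega
          · refine h0 i ?_
            simp only [List.filter_cons, hw, decide_true, if_true, List.length_cons,
              ← hcard, mul_add, mul_one] at hi
            rw [List.filter_append, List.length_append]
            omega
        · have := weight_consDigit_le m a d
          have := hwt m
          simp only [ha, if_false] at *
          omega
    · obtain ⟨d, r, hE, hlt, h0, hr⟩ := ihq cur hN hcur (fun u hu => hq u (by simp [hu]))
        fun u x h₁ h₂ h₃ => by
          rcases hclosed u x h₁ h₂ h₃ with h | h
          · exact Or.inl h
          · rcases List.mem_cons.1 h with rfl | h
            · exact Or.inl hw
            · exact Or.inr h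
      refine ⟨d, r, .skip hw hE, hlt, fun i hi => h0 i ?_, hr⟩
      simpa [List.filter_cons, hw] using hi

/-- If there is an improving `k`-neighbor, then some code prescribes an improvement. -/
theorem exists_code (hc : 0 < c) (ω : Sym2 (Fin n) → ℚ) {k D : ℕ}
    (hD : ∀ v, (L.nbrs v).length ≤ D + 1) (h : ∃ χ', IsImprovingNeighbor G ω χ k χ') :
    ∃ v d r, IsCode c (k * D + 2) k d ∧ Explore L χ d [v] χ r ∧
      totalWeight ω (properEdges G χ) < totalWeight ω (properEdges G r) := by
  classical
  obtain ⟨χ', hk, hχ'⟩ := h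
  -- An improving coloring with the smallest flip; minimality replaces an explicit connectivity
  -- argument.
  obtain ⟨ψ, hψ, hmin⟩ := Finset.exists_min_image
    (Finset.univ.filter fun ψ : Fin n → Fin c =>
      totalWeight ω (properEdges G χ) < totalWeight ω (properEdges G ψ))
    (fun ψ => (flip χ ψ).card) ⟨χ', by simpa using hχ'⟩
  simp only [Finset.mem_filter, Finset.mem_univ, true_and] at hψ hmin
  have hψk : (flip χ ψ).card ≤ k := (hmin χ' hχ').trans hk
  obtain ⟨v, hv⟩ : ∃ v, ψ v ≠ χ v := by
    by_contra! hcon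
    rw [funext hcon] at hψ
    exact lt_irrefl _ hψ
  obtain ⟨a, ha, hac, haz⟩ := exists_digit hv
  set cur := Function.update χ v (ψ v) with hcur
  have hself : cur v = ψ v := by simp [hcur]
  have hoff : ∀ u, u ≠ v → cur u = χ u := fun u hu => by simp [hcur, hu]
  have hflip : flip cur ψ = (flip χ ψ).erase v := by
    ext u
    by_cases hu : u = v
    · simp [hu, flip, hself]
    · simp [hu, flip, hoff]
  have hcard : (flip cur ψ).card + 1 = (flip χ ψ).card := by
    rw [hflip, Finset.card_erase_add_one (by simp [flip, Ne.symm hv])]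
  obtain ⟨d, r, hE, hlt, h0, hwt, hr, hr', hcl⟩ := exists_digits (L := L) (χ := χ) hc ψ D hD _
    (L.nbrs v) cur rfl
    (fun u => by
      by_cases hu : u = v
      · subst hu; exact Or.inr hself
      · exact Or.inl (hoff u hu))
    (fun u hu => ⟨v, ((L.mem_iff v u).1 hu).symm, by rw [hself]; exact hv⟩)
    (fun u x h₁ h₂ _ => by
      by_cases hu : u = v
      · subst hu; exact Or.inr ((L.mem_iff _ _).2 h₂)
      · exact absurd (hoff u hu) h₁)
  refine ⟨v, consDigit a d, r, ⟨?_, ?_, ?_⟩, .take rfl ha haz hE, ?_⟩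
  · rintro (_ | i)
    exacts [hac, hlt i]
  · rintro (_ | i) hi
    · omega
    · refine h0 i ?_
      -- The root has no changed neighbor to discount, so its list counts with `D + 1`. Together
      -- with the digit of the root and `D` for each of the at most `k - 1` other vertices this
      -- gives `k * D + 2`.
      have h₁ := (List.length_filter_le (fun u => decide (cur u = χ u)) (L.nbrs v)).trans (hD v)
      have h₂ : D * ((flip cur ψ).card + 1) ≤ D * k := Nat.mul_le_mul_left _ (by omega)
      rw [mul_add, mul_one, mul_comm D k] at h₂
      omega
  · have h₁ := weight_consDigit_le (k * D + 2) a d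
    have := hwt (k * D + 2)
    simp only [ha, if_false] at h₁
    omega
  -- The complementary part of `ψ` omits the root and so has a smaller flip. By minimality it does
  -- not improve, hence `r` gains at least as much as `ψ`.
  · have hsplit := totalWeight_split ω χ ψ r (fun u => if r u = χ u then ψ u else χ u) hr hcl
      fun _ => rfl
    have hrv := hr' v (by rw [hself]; exact hv)
    have hsmall : (flip χ fun u => if r u = χ u then ψ u else χ u).card < (flip χ ψ).card := by
      refine Finset.card_lt_card (Finset.ssubset_iff_of_subset ?_ |>.2
        ⟨v, by simp [flip, Ne.symm hv], by simp [flip, hrv]⟩)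
      intro u hu
      by_cases hru : r u = χ u <;> simp_all [flip]
    have hnot : ¬ totalWeight ω (properEdges G χ) <
        totalWeight ω (properEdges G fun u => if r u = χ u then ψ u else χ u) :=
      fun hcon => absurd (hmin _ hcon) (by omega)
    linarith

end Explore

/-! ### The order in which codes are tried -/

/-- `y` precedes `d` in the colexicographic order. -/
def Before (y d : ℕ → ℕ) : Prop := ∃ h, y h < d h ∧ ∀ j, h < j → y j = d j

theorem Before.irrefl (d : ℕ → ℕ) : ¬ Before d d := fun ⟨_, h, _⟩ => lt_irrefl _ h

theorem Before.trans {x y d : ℕ → ℕ} (h₁ : Before x y) (h₂ : Before y d) : Before x d := by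
  obtain ⟨a, ha, ha'⟩ := h₁
  obtain ⟨b, hb, hb'⟩ := h₂
  rcases lt_trichotomy a b with h | rfl | h
  · exact ⟨b, by rw [ha' b h]; exact hb, fun j hj => (ha' j (h.trans hj)).trans (hb' j hj)⟩
  · exact ⟨a, ha.trans hb, fun j hj => (ha' j hj).trans (hb' j hj)⟩
  · exact ⟨a, by rw [← hb' a h]; exact ha, fun j hj => (ha' j hj).trans (hb' j (h.trans hj))⟩

theorem Before.total (m : ℕ) (y d : ℕ → ℕ) (h : ∀ i, m ≤ i → y i = d i) :
    Before y d ∨ y = d ∨ Before d y := by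
  induction m with
  | zero => exact Or.inr (Or.inl (funext fun i => h i (Nat.zero_le i)))
  | succ m ih =>
    rcases lt_trichotomy (y m) (d m) with hm | hm | hm
    · exact Or.inl ⟨m, hm, fun j hj => h j hj⟩
    · refine ih fun i hi => ?_
      rcases hi.eq_or_lt with rfl | hi
      exacts [hm, h i hi]
    · exact Or.inr (Or.inr ⟨m, hm, fun j hj => (h j hj).symm⟩)

/-- The digits `d` with those below position `i` replaced by `0`. -/
def clearBelow (i : ℕ) (d : ℕ → ℕ) : ℕ → ℕ := fun j => if j < i then 0 else d j

theorem clearBelow_succ (i : ℕ) (d : ℕ → ℕ) :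
    clearBelow (i + 1) d = Function.update (clearBelow i d) i 0 := by
  funext j
  by_cases h : j = i
  · simp [clearBelow, h]
  · have : j < i + 1 ↔ j < i := by omega
    simp [clearBelow, h, this]

theorem weight_update {m i : ℕ} (hi : i < m) (d : ℕ → ℕ) (a : ℕ) :
    weight m (Function.update d i a) + (if d i = 0 then 0 else 1) =
      weight m d + if a = 0 then 0 else 1 := by
  have hi' : i ∈ Finset.range m := Finset.mem_range.2 hi
  rw [weight, weight, ← Finset.add_sum_erase _ _ hi', ← Finset.add_sum_erase _ _ hi',
    Function.update_self, Finset.sum_congr rfl fun j hj => by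
      rw [Function.update_of_ne (Finset.ne_of_mem_erase hj)]]
  omega

section Successor

variable {c m k : ℕ} {d : ℕ → ℕ}

/-- No code succeeds `d` with the first difference, from the top, below position `i`. -/
def NoneBelow (c m k i : ℕ) (d : ℕ → ℕ) : Prop :=
  ∀ y, IsCode c m k y → ∀ h < i, d h < y h → ¬ ∀ j, h < j → y j = d j

theorem NoneBelow.succ_of_max {i : ℕ} (h : NoneBelow c m k i d) (hd : c ≤ d i + 1) :
    NoneBelow c m k (i + 1) d := by
  intro y hy j hj hlt
  rcases (Nat.lt_succ_iff.1 hj).eq_or_lt with rfl | hj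
  · have := hy.lt j
    omega
  · exact h y hy j hj hlt

/-- A code that agrees with `d` above `i` and is nonzero at `i` has at least one more nonzero digit
than `d` cleared below `i`, which exceeds `k` when the budget is exhausted. -/
theorem NoneBelow.succ_of_weight {i : ℕ} (h : NoneBelow c m k i d) (hi : i < m)
    (hd : d i = 0) (hw : k ≤ weight m (clearBelow i d)) : NoneBelow c m k (i + 1) d := by
  intro y hy j hj hlt heq
  rcases (Nat.lt_succ_iff.1 hj).eq_or_lt with rfl | hj
  · have h₁ : weight m (Function.update (clearBelow j d) j 1) ≤ weight m y := by
      refine Finset.sum_le_sum fun l _ => ?_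
      rcases lt_trichotomy l j with hl | rfl | hl
      · simp [clearBelow, hl.ne, hl]
      · have hy₀ : y l ≠ 0 := by omega
        simp [hy₀]
      · simp [clearBelow, hl.ne', hl.not_gt, heq l hl]
    have h₂ := weight_update hi (clearBelow j d) 1
    have h₃ := hy.weight_le
    have hz : clearBelow j d j = 0 := by simp [clearBelow, hd]
    rw [if_pos hz, if_neg one_ne_zero] at h₂
    omega
  · exact h y hy j hj hlt heq

/-- The code that increments position `i` is the next one. -/
theorem NoneBelow.before_or_eq {i : ℕ} (h : NoneBelow c m k i d) (hd : IsCode c m k d)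
    {y : ℕ → ℕ} (hy : IsCode c m k y)
    (hb : Before y (Function.update (clearBelow i d) i (d i + 1))) : Before y d ∨ y = d := by
  rcases Before.total m y d fun j hj => (hy.eq_zero j hj).trans (hd.eq_zero j hj).symm with
    h' | h' | ⟨l, hl, hl'⟩
  · exact Or.inl h'
  · exact Or.inr h'
  · exfalso
    obtain ⟨b, hb, hb'⟩ := hb
    -- Here `l` is the highest position where `y` and `d` differ, with `d l < y l`. Having excluded
    -- `l < i`, it remains to compare `l` with the highest position `b` where `y` falls below the
    -- incremented code.
    have hli : i ≤ l := by
      by_contra hcon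
      exact h y hy l (by omega) hl fun j hj => (hl' j hj).symm
    rcases lt_trichotomy b i with hbi | rfl | hbi
    · simp [clearBelow, hbi, hbi.ne] at hb
    · simp only [Function.update_self] at hb
      rcases hli.eq_or_lt with rfl | hli
      · omega
      · have := hb' l hli
        simp [clearBelow, hli.ne', hli.not_gt] at this
        omega
    · simp [clearBelow, hbi.ne', hbi.not_gt] at hb
      rcases lt_trichotomy b l with hbl | rfl | hbl
      · have := hb' l hbl
        have hil := hbi.trans hbl
        simp [clearBelow, hil.ne', hil.not_gt] at this
        omega
      · omega
      · have := hl' b hbl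
        omega

theorem before_update_clearBelow (i : ℕ) (d : ℕ → ℕ) :
    Before d (Function.update (clearBelow i d) i (d i + 1)) :=
  ⟨i, by simp, fun j hj => by simp [clearBelow, hj.ne', hj.not_gt]⟩

theorem NoneBelow.before_or_eq_of_length (h : NoneBelow c m k m d) (hd : IsCode c m k d)
    {y : ℕ → ℕ} (hy : IsCode c m k y) : Before y d ∨ y = d := by
  rcases Before.total m y d fun j hj => (hy.eq_zero j hj).trans (hd.eq_zero j hj).symm with
    h' | h' | ⟨l, hl, hl'⟩
  · exact Or.inl h'
  · exact Or.inr h'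
  · refine absurd (fun j hj => (hl' j hj).symm) (h y hy l ?_ hl)
    by_contra hcon
    have h₁ := hy.eq_zero l (by omega)
    omega

end Successor

/-! ### The number of codes -/

/-- The digit sequence with the given first `m` digits. -/
def digits {c m : ℕ} (y : Fin m → Fin c) : ℕ → ℕ := fun i => if h : i < m then y ⟨i, h⟩ else 0

/-- The codes that do not precede `d`. -/
noncomputable def remaining (c m k : ℕ) (d : ℕ → ℕ) : Finset (Fin m → Fin c) :=
  open scoped Classical in {y | weight m (digits y) ≤ k ∧ ¬ Before (digits y) d}

theorem mem_remaining {c m k : ℕ} {d : ℕ → ℕ} {y : Fin m → Fin c} :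
    y ∈ remaining c m k d ↔ weight m (digits y) ≤ k ∧ ¬ Before (digits y) d := by
  simp [remaining]

theorem exists_mem_remaining {c m k : ℕ} {d : ℕ → ℕ} (hd : IsCode c m k d) :
    ∃ y ∈ remaining c m k d, digits y = d := by
  have h : digits (fun i : Fin m => (⟨d i, hd.lt i⟩ : Fin c)) = d := by
    funext i
    by_cases hi : i < m
    · simp [digits, hi]
    · simp [digits, hi, hd.eq_zero i (by omega)]
  refine ⟨_, mem_remaining.2 ⟨?_, ?_⟩, h⟩
  · rw [h]
    exact hd.weight_le
  · rw [h]
    exact Before.irrefl d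

theorem one_le_card_remaining {c m k : ℕ} {d : ℕ → ℕ} (hd : IsCode c m k d) :
    1 ≤ (remaining c m k d).card := by
  obtain ⟨y, hy, _⟩ := exists_mem_remaining hd
  exact Finset.card_pos.2 ⟨y, hy⟩

/-- The number of remaining codes is the potential that pays for the loop over codes: it drops
whenever the search moves to a later code. -/
theorem card_remaining_lt {c m k : ℕ} {d e : ℕ → ℕ} (hd : IsCode c m k d) (h : Before d e) :
    (remaining c m k e).card + 1 ≤ (remaining c m k d).card := by
  obtain ⟨y, hy, hyd⟩ := exists_mem_remaining hd
  refine Finset.card_lt_card (Finset.ssubset_iff_of_subset (fun x hx => ?_) |>.2 ⟨y, hy, ?_⟩)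
  · rw [mem_remaining] at hx ⊢
    exact ⟨hx.1, fun h' => hx.2 (h'.trans h)⟩
  · rw [mem_remaining, hyd]
    exact fun h' => h'.2 h

/-- Give each word the weight `x ^ (number of nonzero digits)` with `0 < x ≤ 1`. All words of length
`m` have total weight `(1 + (c - 1) * x) ^ m`, and each counted word contributes at least `x ^ k`.
-/
theorem card_remaining_le {c m k : ℕ} (hc : 2 ≤ c) (hk : 1 ≤ k) (hkm : k ≤ m) (d : ℕ → ℕ) :
    ((remaining c m k d).card : ℝ) ≤ (((c : ℝ) - 1) * m / k) ^ k * Real.exp 1 ^ k := by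
  have hc' : (1 : ℝ) ≤ (c : ℝ) - 1 := by
    have : (2 : ℝ) ≤ c := by exact_mod_cast hc
    linarith
  have hk' : (0 : ℝ) < k := by exact_mod_cast hk
  have hm' : (k : ℝ) ≤ m := by exact_mod_cast hkm
  have hm₀ : (0 : ℝ) < m := hk'.trans_le hm'
  -- This choice makes `(c - 1) * x = k / m`, so the total weight `(1 + k / m) ^ m` is at most `e ^
  -- k`.
  set x : ℝ := k / (((c : ℝ) - 1) * m) with hx
  have hx₀ : 0 < x := by positivity
  have hx₁ : x ≤ 1 := by
    rw [hx, div_le_one (by positivity)]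
    nlinarith
  have hsum : ∑ y : Fin m → Fin c, ∏ i, (if (y i : ℕ) = 0 then 1 else x) =
      (1 + ((c : ℝ) - 1) * x) ^ m := by
    have h := Finset.prod_univ_sum (fun _ : Fin m => (Finset.univ : Finset (Fin c)))
      (fun _ a => if (a : ℕ) = 0 then 1 else x)
    rw [Fintype.piFinset_univ] at h
    rw [← h, Finset.prod_const, Finset.card_univ, Fintype.card_fin]
    congr 1
    obtain ⟨c, rfl⟩ : ∃ b, c = b + 1 := ⟨c - 1, by omega⟩
    rw [Fin.sum_univ_succ]
    simp
  have hprod : ∀ y : Fin m → Fin c,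
      ∏ i, (if (y i : ℕ) = 0 then 1 else x) = x ^ weight m (digits y) := by
    intro y
    rw [weight, Finset.sum_range, ← Finset.prod_pow_eq_pow_sum]
    refine Finset.prod_congr rfl fun i _ => ?_
    by_cases h : (y i : ℕ) = 0 <;> simp [digits, h]
  have h₁ : ((remaining c m k d).card : ℝ) * x ^ k ≤ (1 + ((c : ℝ) - 1) * x) ^ m := by
    rw [← hsum, ← nsmul_eq_mul, ← Finset.sum_const]
    refine (Finset.sum_le_sum fun y hy => ?_).trans
      (Finset.sum_le_sum_of_subset_of_nonneg (Finset.subset_univ (remaining c m k d)) ?_)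
    · rw [hprod]
      exact pow_le_pow_of_le_one hx₀.le hx₁ (mem_remaining.1 hy).1
    · intro y _ _
      rw [hprod]
      positivity
  have h₂ : (1 + ((c : ℝ) - 1) * x) ^ m ≤ Real.exp 1 ^ k := by
    have hcx : ((c : ℝ) - 1) * x = k / m := by
      rw [hx]
      field_simp
    rw [hcx, ← Real.exp_nat_mul, mul_one]
    calc (1 + (k : ℝ) / m) ^ m ≤ Real.exp (k / m) ^ m := by
          gcongr
          rw [add_comm]
          exact Real.add_one_le_exp _
      _ = Real.exp k := by
          rw [← Real.exp_nat_mul]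
          congr 1
          field_simp
  have hx' : (((c : ℝ) - 1) * m / k) ^ k * x ^ k = 1 := by
    rw [← mul_pow, hx]
    have : ((c : ℝ) - 1) * m / k * (k / (((c : ℝ) - 1) * m)) = 1 := by field_simp
    rw [this, one_pow]
  calc ((remaining c m k d).card : ℝ)
      = (((c : ℝ) - 1) * m / k) ^ k * ((remaining c m k d).card * x ^ k) := by
        rw [mul_left_comm, hx', mul_one]
    _ ≤ _ := by
        gcongr
        exact h₁.trans h₂

/-- The number of codes for maximum degree `D + 1`. -/
theorem card_remaining_le_pow {c k D : ℕ} (hc : 2 ≤ c) (hk : 1 ≤ k) (hD : 1 ≤ D) (d : ℕ → ℕ) :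
    ((remaining c (k * D + 2) k d).card : ℝ) ≤
      Real.exp 2 * ((((c : ℝ) - 1) * Real.exp 1) ^ k * (D : ℝ) ^ k) := by
  have hk' : (1 : ℝ) ≤ k := by exact_mod_cast hk
  have hD' : (1 : ℝ) ≤ D := by exact_mod_cast hD
  have hc' : (1 : ℝ) ≤ (c : ℝ) - 1 := by
    have : (2 : ℝ) ≤ c := by exact_mod_cast hc
    linarith
  refine (card_remaining_le hc hk (by nlinarith) d).trans ?_
  -- Since `D ≥ 1`, the extra two digits fit into a factor `1 + 2 / k`, whose `k`-th power is at
  -- most `e ^ 2`.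
  have h₁ : ((c : ℝ) - 1) * ((k * D + 2 : ℕ) : ℝ) / k ≤ ((c : ℝ) - 1) * (D * (1 + 2 / k)) := by
    rw [mul_div_assoc]
    gcongr
    push_cast
    rw [div_le_iff₀ (by linarith)]
    have : (D : ℝ) * (1 + 2 / k) * k = D * k + D * 2 := by field_simp
    rw [this]
    nlinarith
  have h₂ : (1 + 2 / (k : ℝ)) ^ k ≤ Real.exp 2 := by
    calc (1 + 2 / (k : ℝ)) ^ k ≤ Real.exp (2 / k) ^ k := by
          gcongr
          rw [add_comm]
          exact Real.add_one_le_exp _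
      _ = Real.exp 2 := by
          rw [← Real.exp_nat_mul]
          congr 1
          field_simp
  calc (((c : ℝ) - 1) * ((k * D + 2 : ℕ) : ℝ) / k) ^ k * Real.exp 1 ^ k
      ≤ (((c : ℝ) - 1) * (D * (1 + 2 / k))) ^ k * Real.exp 1 ^ k := by gcongr
    _ = (1 + 2 / (k : ℝ)) ^ k * ((((c : ℝ) - 1) * Real.exp 1) ^ k * (D : ℝ) ^ k) := by
        rw [mul_pow, mul_pow, mul_pow]
        ring
    _ ≤ _ := by gcongr

/-! ### Correctness of the program -/

/-- The array `f` starts with the entries of `l`. -/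
def ListAt {n : ℕ} (f : ℕ → ℕ) (l : List (Fin n)) : Prop :=
  ∀ i (h : i < l.length), f i = l[i]

theorem ListAt.concat {n : ℕ} {f : ℕ → ℕ} {l : List (Fin n)} (h : ListAt f l) (u : Fin n) :
    ListAt (Function.update f l.length u) (l ++ [u]) := by
  intro i hi
  simp only [List.length_append, List.length_singleton] at hi
  by_cases hil : i = l.length
  · subst hil
    simp
  · rw [Function.update_of_ne hil, List.getElem_append_left (by omega)]
    exact h i (by omega)

section

variable {n c : ℕ} {G : SimpleGraph (Fin n)}

/-- The arrays that hold the input. -/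
structure Stored (L : AdjLists G) (ω : Sym2 (Fin n) → ℚ) (χ : Fin n → Fin c) (s : State) :
    Prop where
  start : ∀ v : Fin n, s.arr 0 (v + 1) = s.arr 0 v + (L.nbrs v).length
  nbr : ∀ (v : Fin n) (i : ℕ) (h : i < (L.nbrs v).length),
    s.arr 1 (s.arr 0 v + i) = (L.nbrs v)[i]
  wt : ∀ (v : Fin n) (i : ℕ) (h : i < (L.nbrs v).length),
    s.warr 0 (s.arr 0 v + i) = ω s(v, (L.nbrs v)[i])
  label : ∀ v : Fin n, s.arr 2 v = χ v

/-- The input and the constants are stored as the search expects. -/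
structure Ready (L : AdjLists G) (ω : Sym2 (Fin n) → ℚ) (χ : Fin n → Fin c) (k m : ℕ)
    (s : State) : Prop extends Stored L ω χ s where
  reg_n : s.reg 0 = n
  reg_k : s.reg 1 = k
  reg_one : s.reg 2 = 1
  reg_zero : s.reg 3 = 0
  reg_c : s.reg 4 = c
  reg_m : s.reg 5 = m
  wreg_zero : s.wreg 1 = 0

/-- The program does not write to the input. -/
def Cmd.keepsArrays (p : Cmd) : Bool :=
  p.keeps (1, 0) && p.keeps (1, 1) && p.keeps (1, 2) && p.keeps (3, 0)

/-- The program does not write to the input and the constants. -/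
def Cmd.keepsInput (p : Cmd) : Bool :=
  p.keepsArrays && p.keeps (0, 0) && p.keeps (0, 1) && p.keeps (0, 2) && p.keeps (0, 3) &&
    p.keeps (0, 4) && p.keeps (0, 5) && p.keeps (2, 1)

variable {L : AdjLists G} {ω : Sym2 (Fin n) → ℚ} {χ : Fin n → Fin c} {k m : ℕ} {s s' : State}

theorem Stored.of_frame {p : Cmd} (h : Stored L ω χ s) (f : Frame p s s')
    (hp : p.keepsArrays = true) : Stored L ω χ s' := by
  simp only [Cmd.keepsArrays, Bool.and_eq_true] at hp
  obtain ⟨⟨⟨h0, h1⟩, h2⟩, h3⟩ := hp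
  have h0 := f.arr _ h0
  have h1 := f.arr _ h1
  have h2 := f.arr _ h2
  have h3 := f.warr _ h3
  exact ⟨by rw [h0]; exact h.start, by rw [h0, h1]; exact h.nbr, by rw [h0, h3]; exact h.wt,
    by rw [h2]; exact h.label⟩

theorem Ready.of_frame {p : Cmd} (h : Ready L ω χ k m s) (f : Frame p s s')
    (hp : p.keepsInput = true) : Ready L ω χ k m s' := by
  simp only [Cmd.keepsInput, Bool.and_eq_true] at hp
  obtain ⟨⟨⟨⟨⟨⟨⟨ha, h0⟩, h1⟩, h2⟩, h3⟩, h4⟩, h5⟩, hw⟩ := hp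
  exact ⟨h.toStored.of_frame f ha, (f.reg _ h0).trans h.reg_n, (f.reg _ h1).trans h.reg_k,
    (f.reg _ h2).trans h.reg_one, (f.reg _ h3).trans h.reg_zero, (f.reg _ h4).trans h.reg_c,
    (f.reg _ h5).trans h.reg_m, (f.wreg _ hw).trans h.wreg_zero⟩

theorem recolorGain_concat (cur : Fin n → Fin c) (w : Fin n) (x z : Fin c) (l : List (Fin n))
    (u : Fin n) : recolorGain ω cur w x z (l ++ [u]) = recolorGain ω cur w x z l +
      if cur u = x then ω s(w, u) else if cur u = z then - ω s(w, u) else 0 := by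
  simp [recolorGain]

/-- The gain is evaluated with the colors before the change; `recolor` stores the new color of `w`
only afterwards. -/
theorem exec_nbrLoop (hs : Ready L ω χ k m s) (w : Fin n) (x z : Fin c) (q : List (Fin n))
    (cur : Fin n → Fin c) (hx : s.reg 14 = x) (hz : s.reg 17 = z)
    (ha : s.reg 18 = s.arr 0 w) (hb : s.reg 19 = s.arr 0 (w + 1)) (htail : s.reg 11 = q.length)
    (hq : ListAt (s.arr 4) q) (hcur : ∀ u : Fin n, s.arr 3 u = cur u) :
    Exec nbrLoop s (14 * (L.nbrs w).length + 1) fun _ s' =>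
      s'.reg 11 = (q ++ L.nbrs w).length ∧ ListAt (s'.arr 4) (q ++ L.nbrs w) ∧
      s'.wreg 0 = s.wreg 0 + recolorGain ω cur w x z (L.nbrs w) := by
  refine Exec.loop (fun τ s' => ∃ j, j ≤ (L.nbrs w).length ∧ s'.reg 18 = s.arr 0 w + j ∧
    s'.reg 11 = (q ++ (L.nbrs w).take j).length ∧
    ListAt (s'.arr 4) (q ++ (L.nbrs w).take j) ∧
    s'.wreg 0 = s.wreg 0 + recolorGain ω cur w x z ((L.nbrs w).take j) ∧
    14 * ((L.nbrs w).length - j) + 1 ≤ τ) ?_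
    ⟨0, by omega, by omega, by simpa using htail, by simpa using hq, by simp [recolorGain],
      by omega⟩
  rintro τ s₁ f₁ ⟨j, hj, h18, h11, h4, hg, hτ⟩
  have hs₁ := hs.of_frame f₁ rfl
  have h19 : s₁.reg 19 = s.arr 0 w + (L.nbrs w).length := by
    rw [f₁.reg 19 rfl, hb, hs.start]
  refine ⟨by omega, fun hlt => ?_, fun hlt => ?_⟩
  · simp only [Test.Holds, h18, h19, add_lt_add_iff_left] at hlt
    have harr : s₁.arr 0 = s.arr 0 := f₁.arr 0 rfl
    have hnb := hs₁.nbr w j hlt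
    have hwt := hs₁.wt w j hlt
    rw [harr] at hnb hwt
    have htake : (L.nbrs w).take (j + 1) = (L.nbrs w).take j ++ [(L.nbrs w)[j]] :=
      (List.take_append_getElem hlt).symm
    have hcur₁ : s₁.arr 3 ((L.nbrs w)[j] : Fin n) = cur (L.nbrs w)[j] := by
      rw [f₁.arr 3 rfl, hcur]
    have hfin : ∀ a b : Fin c, (a : ℕ) = b ↔ a = b := fun a b => Fin.val_inj
    refine Exec.seq (Exec.block 7 rfl (by omega) fun s₂ e₂ f₂ => ?_)
    have h18₂ : s₂.reg 18 = s.arr 0 w + (j + 1) := by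
      simp [e₂, execAll, Instr.exec, h18, hs₁.reg_one, add_assoc]
    have h11₂ : s₂.reg 11 = (q ++ (L.nbrs w).take (j + 1)).length := by
      rw [htake, ← List.append_assoc, List.length_append, ← h11]
      simp [e₂, execAll, Instr.exec, hs₁.reg_one]
    have h4₂ : ListAt (s₂.arr 4) (q ++ (L.nbrs w).take (j + 1)) := by
      have := h4.concat (L.nbrs w)[j]
      rw [htake, ← List.append_assoc]
      rw [← h11] at this
      simpa [e₂, execAll, Instr.exec, h18, hnb] using this
    have h21₂ : s₂.reg 21 = cur (L.nbrs w)[j] := by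
      simp [e₂, execAll, Instr.exec, h18, hnb, hcur₁]
    have hg₂ : s₂.wreg 2 = ω s(w, (L.nbrs w)[j]) := by
      simp [e₂, execAll, Instr.exec, h18, hwt]
    have hx₂ : s₂.reg 14 = x := by rw [f₂.reg 14 rfl, f₁.reg 14 rfl, hx]
    have hz₂ : s₂.reg 17 = z := by rw [f₂.reg 17 rfl, f₁.reg 17 rfl, hz]
    have hw₂ : s₂.wreg 0 = s₁.wreg 0 := f₂.wreg 0 rfl
    refine Exec.cond (by omega) (fun hb₁ => ?_) fun hb₁ => Exec.cond (by omega) (fun hb₂ => ?_)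
      fun hb₂ => ?_
    · simp only [Test.Holds, h21₂, hx₂, hfin] at hb₁
      refine Exec.block 2 rfl (by omega) fun s₃ e₃ f₃ => ⟨j + 1, hlt, ?_, ?_, ?_, ?_, by omega⟩
      · rw [f₃.reg 18 rfl, h18₂]
      · rw [f₃.reg 11 rfl, h11₂]
      · rw [f₃.arr 4 rfl]; exact h4₂
      · rw [htake, recolorGain_concat, if_pos hb₁]
        simp [e₃, execAll, Instr.exec, hg₂, hw₂, hg]
        ring
    · simp only [Test.Holds, h21₂, hx₂, hz₂, hfin] at hb₁ hb₂
      refine Exec.block 2 rfl (by omega) fun s₃ e₃ f₃ => ⟨j + 1, hlt, ?_, ?_, ?_, ?_, by omega⟩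
      · rw [f₃.reg 18 rfl, h18₂]
      · rw [f₃.reg 11 rfl, h11₂]
      · rw [f₃.arr 4 rfl]; exact h4₂
      · rw [htake, recolorGain_concat, if_neg hb₁, if_pos hb₂]
        simp [e₃, execAll, Instr.exec, hg₂, hw₂, hg]
        ring
    · simp only [Test.Holds, h21₂, hx₂, hz₂, hfin] at hb₁ hb₂
      refine Exec.block 1 rfl (by omega) fun s₃ e₃ f₃ => ⟨j + 1, hlt, ?_, ?_, ?_, ?_, by omega⟩
      · rw [f₃.reg 18 rfl, h18₂]
      · rw [f₃.reg 11 rfl, h11₂]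
      · rw [f₃.arr 4 rfl]; exact h4₂
      · rw [htake, recolorGain_concat, if_neg hb₁, if_neg hb₂]
        simp [e₃, execAll, hw₂, hg]
  · simp only [Test.Holds, h18, h19, add_lt_add_iff_left] at hlt
    obtain rfl : j = (L.nbrs w).length := by omega
    rw [List.take_length] at h11 h4 hg
    exact ⟨h11, h4, hg⟩

theorem exec_recolor (hs : Ready L ω χ k m s) (w : Fin n) (a : ℕ) (q : List (Fin n))
    (cur : Fin n → Fin c) (ha₀ : a ≠ 0) (hac : a < c) (hw : s.reg 13 = w)
    (hx : s.reg 14 = χ w) (ha : s.reg 16 = a) (hcw : cur w = χ w) (htail : s.reg 11 = q.length)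
    (hq : ListAt (s.arr 4) q) (hcur : ∀ u : Fin n, s.arr 3 u = cur u)
    (hg : s.wreg 0 = totalWeight ω (properEdges G cur) - totalWeight ω (properEdges G χ)) :
    Exec recolor s (14 * (L.nbrs w).length + 14) fun _ s' =>
      ∃ z : Fin c, ((z : ℕ) = χ w + a ∨ (z : ℕ) + c = χ w + a) ∧
      s'.reg 11 = (q ++ L.nbrs w).length ∧ ListAt (s'.arr 4) (q ++ L.nbrs w) ∧
      (∀ u : Fin n, s'.arr 3 u = Function.update cur w z u) ∧
      s'.wreg 0 = totalWeight ω (properEdges G (Function.update cur w z)) -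
        totalWeight ω (properEdges G χ) := by
  obtain ⟨z, hz⟩ : ∃ z : Fin c, (z : ℕ) = χ w + a ∨ (z : ℕ) + c = χ w + a := by
    have := (χ w).2
    by_cases h : (χ w : ℕ) + a < c
    · exact ⟨⟨χ w + a, h⟩, Or.inl rfl⟩
    · refine ⟨⟨χ w + a - c, by omega⟩, Or.inr ?_⟩
      simp only
      omega
  have hzx : z ≠ χ w := by
    rintro rfl
    omega
  refine Exec.seq (Exec.block 2 rfl (by omega) fun s₁ e₁ f₁ => Exec.seq ?_)
  have hs₁ := hs.of_frame f₁ rfl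
  have h17 : s₁.reg 17 = χ w + a := by simp [e₁, execAll, Instr.exec, hx, ha]
  refine (show Exec _ s₁ 3 fun _ s₂ => s₂.reg 17 = z from ?_).save 3 (by omega)
    fun τ s₂ hτ f₂ hz₂ => ?_
  · refine Exec.cond (by omega) (fun hb => ?_) fun hb => ?_ <;>
      simp only [Test.Holds, h17, hs₁.reg_c] at hb
    · refine Exec.block 1 rfl (by omega) fun s₂ e₂ f₂ => ?_
      rw [f₂.reg 17 rfl, h17]
      omega
    · refine Exec.block 2 rfl (by omega) fun s₂ e₂ f₂ => ?_
      have := z.2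
      simp [e₂, execAll, Instr.exec, h17, hs₁.reg_c]
      omega
  · have hs₂ := hs₁.of_frame f₂ rfl
    refine Exec.seq (Exec.block 4 rfl (by omega) fun s₃ e₃ f₃ => Exec.seq ?_)
    have hs₃ := hs₂.of_frame f₃ rfl
    have hw₂ : s₂.reg 13 = w := by rw [f₂.reg 13 rfl, f₁.reg 13 rfl, hw]
    refine (exec_nbrLoop hs₃ w (χ w) z q cur ?_ ?_ ?_ ?_ ?_ ?_ ?_).save
      (14 * (L.nbrs w).length + 1) (by omega) fun τ₄ s₄ hτ₄ f₄ ⟨h11, h4, hg₄⟩ => ?_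
    · rw [f₃.reg 14 rfl, f₂.reg 14 rfl, f₁.reg 14 rfl, hx]
    · rw [f₃.reg 17 rfl, hz₂]
    · simp [e₃, execAll, Instr.exec, hw₂]
    · simp [e₃, execAll, Instr.exec, hw₂, hs₂.reg_one]
    · rw [f₃.reg 11 rfl, f₂.reg 11 rfl, f₁.reg 11 rfl, htail]
    · rw [f₃.arr 4 rfl, f₂.arr 4 rfl, f₁.arr 4 rfl]; exact hq
    · rw [f₃.arr 3 rfl, f₂.arr 3 rfl, f₁.arr 3 rfl]; exact hcur
    refine Exec.block 2 rfl (by omega) fun s₅ e₅ f₅ => ⟨z, hz, ?_, ?_, ?_, ?_⟩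
    · rw [f₅.reg 11 rfl, h11]
    · rw [f₅.arr 4 rfl]; exact h4
    · intro u
      have h3 : s₄.arr 3 u = cur u := by
        rw [f₄.arr 3 rfl, f₃.arr 3 rfl, f₂.arr 3 rfl, f₁.arr 3 rfl, hcur]
      have h13 : s₄.reg 13 = w := by rw [f₄.reg 13 rfl, f₃.reg 13 rfl, hw₂]
      have h17' : s₄.reg 17 = z := by rw [f₄.reg 17 rfl, f₃.reg 17 rfl, hz₂]
      by_cases huw : u = w
      · subst huw
        simp [e₅, execAll, Instr.exec, h13, h17']
      · have : (u : ℕ) ≠ w := fun h => huw (Fin.ext h)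
        simp [e₅, execAll, Instr.exec, h13, this, h3, huw]
    · rw [f₅.wreg 0 rfl, hg₄, f₃.wreg 0 rfl, f₂.wreg 0 rfl, f₁.wreg 0 rfl, hg,
        totalWeight_update L ω cur w z (by rw [hcw]; exact hzx), hcw]
      ring

end

/-! ### Running one code, undoing it, and finding its successor -/

section

variable {n c : ℕ} {G : SimpleGraph (Fin n)}
variable {L : AdjLists G} {ω : Sym2 (Fin n) → ℚ} {χ : Fin n → Fin c} {k m : ℕ} {s s' : State}

theorem weight_tail {d : ℕ → ℕ} (hd : ∀ i, m ≤ i → d i = 0) (p : ℕ) :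
    weight m (fun i => d (p + i)) =
      (if d p = 0 then 0 else 1) + weight m fun i => d (p + 1 + i) := by
  rw [weight_shift (d := fun i => d (p + i)) (hd _ (by omega))]
  simp only [add_zero, add_assoc, add_comm 1]

/-- The queue is kept in full, because it contains all changed vertices: the coloring can then be
restored by walking through at most `M * k + 1` entries instead of all `n` vertices. -/
theorem exec_explore (hs : Ready L ω χ k m s) {M : ℕ} (hM : ∀ v, (L.nbrs v).length ≤ M)
    (v : Fin n) (hv : s.reg 6 = v) (hcur : ∀ u : Fin n, s.arr 3 u = χ u)
    (hd : IsCode c m k (s.arr 5)) :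
    Exec explore s (46 * (M * k) + 39) fun _ s' => ∃ (q : List (Fin n)) (r : Fin n → Fin c),
      Explore L χ (s.arr 5) [v] χ r ∧ (∀ u : Fin n, s'.arr 3 u = r u) ∧
      s'.wreg 0 = totalWeight ω (properEdges G r) - totalWeight ω (properEdges G χ) ∧
      s'.reg 11 = q.length ∧ ListAt (s'.arr 4) q ∧ (∀ u, r u ≠ χ u → u ∈ q) ∧
      q.length ≤ M * k + 1 := by
  refine Exec.seq (Exec.block 6 rfl (by omega) fun s₁ e₁ f₁ => ?_)
  have hs₁ := hs.of_frame f₁ rfl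
  have h5₁ : s₁.arr 5 = s.arr 5 := f₁.arr 5 rfl
  have hweight : M * weight m (fun i => s.arr 5 i) ≤ M * k := Nat.mul_le_mul_left _ hd.weight_le
  -- Each pending queue entry holds 32 credits. Each nonzero digit not yet read holds 46 credits for
  -- each of up to `M` neighbors: 14 to scan and queue one, 32 to visit it later. The `Explore`
  -- clause is in continuation form: any completion from the current queue completes the run from
  -- the root.
  refine Exec.loop (fun τ s' => ∃ (head p : ℕ) (q : List (Fin n)) (cur : Fin n → Fin c),
    head ≤ q.length ∧ s'.reg 10 = head ∧ s'.reg 11 = q.length ∧ s'.reg 12 = p ∧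
    ListAt (s'.arr 4) q ∧ (∀ u : Fin n, s'.arr 3 u = cur u) ∧
    s'.wreg 0 = totalWeight ω (properEdges G cur) - totalWeight ω (properEdges G χ) ∧
    (∀ u, cur u ≠ χ u → u ∈ q) ∧
    (∀ r, Explore L χ (fun i => s.arr 5 (p + i)) (q.drop head) cur r →
      Explore L χ (s.arr 5) [v] χ r) ∧
    q.length + M * weight m (fun i => s.arr 5 (p + i)) ≤ M * k + 1 ∧
    32 * (q.length - head) + 46 * (M * weight m fun i => s.arr 5 (p + i)) + 1 ≤ τ) ?_
    ⟨0, 0, [v], χ, by simp, by simp [e₁, execAll, Instr.exec],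
      by simp [e₁, execAll, Instr.exec], by simp [e₁, execAll, Instr.exec], ?_,
      by rw [f₁.arr 3 rfl]; exact hcur, by simp [e₁, execAll, Instr.exec], by simp,
      by simp, by simp; omega, by simp; omega⟩
  swap
  · intro i hi
    obtain rfl : i = 0 := by simpa using hi
    simp [e₁, execAll, Instr.exec, hv, hs.reg_zero]
  rintro τ s₂ f₂ ⟨head, p, q, cur, hhead, h10, h11, h12, h4, h3, hg, hmem, hE, hlen, hτ⟩
  have hs₂ := hs₁.of_frame f₂ rfl
  refine ⟨by omega, fun hlt => ?_, fun hlt => ?_⟩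
  · simp only [Test.Holds, h10, h11] at hlt
    set w := q[head] with hw
    have hdrop : q.drop head = w :: q.drop (head + 1) := List.drop_eq_getElem_cons hlt
    have h4w := h4 head hlt
    refine Exec.seq (Exec.block 5 rfl (by omega) fun s₃ e₃ f₃ => ?_)
    have hs₃ := hs₂.of_frame f₃ rfl
    have h5₃ : s₃.arr 5 = s.arr 5 := by rw [f₃.arr 5 rfl, f₂.arr 5 rfl, h5₁]
    have h10₃ : s₃.reg 10 = head + 1 := by
      simp [e₃, execAll, Instr.exec, h10, hs₂.reg_one]
    have h13₃ : s₃.reg 13 = w := by simp [e₃, execAll, Instr.exec, h10, h4w, hw]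
    have h14₃ : s₃.reg 14 = cur w := by
      rw [← h3]
      simp [e₃, execAll, Instr.exec, h10, h4w, hw]
    have h15₃ : s₃.reg 15 = χ w := by
      rw [← hs₂.label]
      simp [e₃, execAll, Instr.exec, h10, h4w, hw]
    refine Exec.cond (by omega) (fun hb => ?_) fun hb => ?_ <;>
      simp only [Test.Holds, h14₃, h15₃, Fin.val_inj] at hb
    · refine Exec.seq (Exec.block 3 rfl (by omega) fun s₄ e₄ f₄ => ?_)
      have hs₄ := hs₃.of_frame f₄ rfl
      have h16₄ : s₄.reg 16 = s.arr 5 p := by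
        simp [e₄, execAll, Instr.exec, f₃.reg 12 rfl, h12, h5₃]
      have h12₄ : s₄.reg 12 = p + 1 := by
        simp [e₄, execAll, Instr.exec, f₃.reg 12 rfl, h12, hs₃.reg_one]
      have h10₄ : s₄.reg 10 = head + 1 := by rw [f₄.reg 10 rfl, h10₃]
      have h11₄ : s₄.reg 11 = q.length := by rw [f₄.reg 11 rfl, f₃.reg 11 rfl, h11]
      have h4₄ : ListAt (s₄.arr 4) q := by rw [f₄.arr 4 rfl, f₃.arr 4 rfl]; exact h4
      have h3₄ : ∀ u : Fin n, s₄.arr 3 u = cur u := by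
        rw [f₄.arr 3 rfl, f₃.arr 3 rfl]; exact h3
      have hg₄ : s₄.wreg 0 = totalWeight ω (properEdges G cur) -
          totalWeight ω (properEdges G χ) := by rw [f₄.wreg 0 rfl, f₃.wreg 0 rfl, hg]
      have hshift : (fun i => s.arr 5 (p + (i + 1))) = fun i => s.arr 5 (p + 1 + i) := by
        funext i
        rw [add_assoc, add_comm i]
      have htail := weight_tail hd.eq_zero p
      refine Exec.cond (by omega) (fun hb₂ => ?_) fun hb₂ => ?_ <;>
        simp only [Test.Holds, hs₄.reg_zero, h16₄] at hb₂
      · rw [if_neg (by omega)] at htail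
        rw [htail, mul_add, mul_one] at hlen hτ
        have hMw := hM w
        refine (exec_recolor hs₄ w (s.arr 5 p) q cur (by omega) (hd.lt p) ?_ ?_ h16₄ hb h11₄ h4₄
          h3₄ hg₄).save (14 * (L.nbrs w).length + 14) (by omega)
          fun τ₅ s₅ hτ₅ f₅ ⟨z, hz, h11₅, h4₅, h3₅, hg₅⟩ =>
            ⟨head + 1, p + 1, q ++ L.nbrs w, Function.update cur w z, ?_, ?_, h11₅, ?_, h4₅, h3₅,
              hg₅, ?_, ?_, ?_, ?_⟩
        · rw [f₄.reg 13 rfl, h13₃]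
        · rw [f₄.reg 14 rfl, h14₃, hb]
        · rw [List.length_append]
          omega
        · rw [f₅.reg 10 rfl, h10₄]
        · rw [f₅.reg 12 rfl, h12₄]
        · intro u hu
          rw [List.mem_append]
          left
          by_cases huw : u = w
          · rw [huw]
            exact List.getElem_mem hlt
          · rw [Function.update_of_ne huw] at hu
            exact hmem u hu
        · intro r hr
          refine hE r ?_
          rw [hdrop]
          refine Explore.take hb (by simpa using hb₂.ne') (by simpa using hz) ?_
          rw [hshift]
          rwa [List.drop_append_of_le_length (by omega)] at hr
        · rw [List.length_append]
          omega
        · rw [List.length_append]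
          omega
      · rw [if_pos (by omega), zero_add] at htail
        rw [htail] at hlen hτ
        refine Exec.block 1 rfl (by omega) fun s₅ e₅ f₅ =>
          ⟨head + 1, p + 1, q, cur, hlt, ?_, ?_, ?_, ?_, ?_, ?_, hmem, fun r hr => hE r ?_, hlen,
            by omega⟩
        · rw [f₅.reg 10 rfl, h10₄]
        · rw [f₅.reg 11 rfl, h11₄]
        · rw [f₅.reg 12 rfl, h12₄]
        · rw [f₅.arr 4 rfl]; exact h4₄
        · rw [f₅.arr 3 rfl]; exact h3₄
        · rw [f₅.wreg 0 rfl, hg₄]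
        · rw [hdrop]
          refine Explore.reject hb ?_ ?_
          · rw [add_zero]
            omega
          · rw [hshift]
            exact hr
    · refine Exec.block 1 rfl (by omega) fun s₄ e₄ f₄ =>
        ⟨head + 1, p, q, cur, hlt, ?_, ?_, ?_, ?_, ?_, ?_, hmem, fun r hr => hE r ?_, hlen,
          by omega⟩
      · rw [f₄.reg 10 rfl, h10₃]
      · rw [f₄.reg 11 rfl, f₃.reg 11 rfl, h11]
      · rw [f₄.reg 12 rfl, f₃.reg 12 rfl, h12]
      · rw [f₄.arr 4 rfl, f₃.arr 4 rfl]; exact h4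
      · rw [f₄.arr 3 rfl, f₃.arr 3 rfl]; exact h3
      · rw [f₄.wreg 0 rfl, f₃.wreg 0 rfl, hg]
      · rw [hdrop]
        exact Explore.skip hb hr
  · simp only [Test.Holds, h10, h11] at hlt
    refine ⟨q, cur, hE cur ?_, h3, hg, h11, h4, hmem, by omega⟩
    rw [List.drop_eq_nil_of_le (by omega)]
    exact Explore.nil _ _

theorem exec_undo (hs : Ready L ω χ k m s) (q : List (Fin n)) (r : Fin n → Fin c)
    (h3 : ∀ u : Fin n, s.arr 3 u = r u) (h11 : s.reg 11 = q.length) (h4 : ListAt (s.arr 4) q)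
    (hmem : ∀ u, r u ≠ χ u → u ∈ q) :
    Exec undo s (6 * q.length + 3) fun _ s' => ∀ u : Fin n, s'.arr 3 u = χ u := by
  refine Exec.seq (Exec.block 2 rfl (by omega) fun s₁ e₁ f₁ => ?_)
  have hs₁ := hs.of_frame f₁ rfl
  -- A vertex is either restored or does not occur among the first `j` entries. Repeated entries are
  -- harmless, as restoring twice changes nothing.
  refine Exec.loop (fun τ s' => ∃ j ≤ q.length, s'.reg 14 = j ∧
    (∀ u : Fin n, s'.arr 3 u = χ u ∨ s'.arr 3 u = r u ∧ ∀ i < j, q[i]? ≠ some u) ∧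
    6 * (q.length - j) + 1 ≤ τ) ?_
    ⟨0, by omega, by simp [e₁, execAll, Instr.exec], fun u => Or.inr ⟨?_, by simp⟩, by omega⟩
  swap
  · rw [f₁.arr 3 rfl, h3]
  rintro τ s₂ f₂ ⟨j, hj, h14, h3₂, hτ⟩
  have hs₂ := hs₁.of_frame f₂ rfl
  have h11₂ : s₂.reg 11 = q.length := by rw [f₂.reg 11 rfl, f₁.reg 11 rfl, h11]
  refine ⟨by omega, fun hlt => ?_, fun hlt => ?_⟩ <;> simp only [Test.Holds, h14, h11₂] at hlt
  · have h4j : s₂.arr 4 j = q[j] := by rw [f₂.arr 4 rfl, f₁.arr 4 rfl, h4 j hlt]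
    have hlab := hs₂.label q[j]
    refine Exec.block 5 rfl (by omega) fun s₃ e₃ f₃ => ⟨j + 1, hlt, ?_, fun u => ?_, by omega⟩
    · simp [e₃, execAll, Instr.exec, h14, hs₂.reg_one]
    · by_cases hu : u = q[j]
      · subst hu
        left
        simp [e₃, execAll, Instr.exec, h14, h4j, hlab]
      · have hu' : (u : ℕ) ≠ (q[j] : Fin n) := fun h => hu (Fin.ext h)
        have h3u : s₃.arr 3 u = s₂.arr 3 u := by
          simp [e₃, execAll, Instr.exec, h14, h4j, hu']
        rw [h3u]
        refine (h3₂ u).imp_right fun h => ⟨h.1, fun i hi => ?_⟩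
        rcases (Nat.lt_succ_iff.1 hi).eq_or_lt with rfl | hi
        · rw [List.getElem?_eq_getElem hlt]
          simpa using Ne.symm hu
        · exact h.2 i hi
  · intro u
    rcases h3₂ u with h | ⟨h, hi⟩
    · exact h
    · by_cases hru : r u = χ u
      · rw [h, hru]
      · obtain ⟨i, hi', hiu⟩ := List.getElem_of_mem (hmem u hru)
        refine absurd ?_ (hi i (by omega))
        rw [List.getElem?_eq_getElem hi', hiu]

theorem weight_clearBelow_le (i : ℕ) (d : ℕ → ℕ) : weight m (clearBelow i d) ≤ weight m d := by
  refine Finset.sum_le_sum fun j _ => ?_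
  by_cases h : j < i <;> simp [clearBelow, h]

/-- The successor increments the lowest position that admits it and clears everything below. If
there is none, the array ends up cleared with weight `0`, which is the first code for the next root.
-/
theorem exec_nextCode (hs : Ready L ω χ k m s) (hc : 2 ≤ c) {d : ℕ → ℕ} (hd : IsCode c m k d)
    (h5 : s.arr 5 = d) (h8 : s.reg 8 = weight m d) (h7 : s.reg 7 = 1) :
    Exec nextCode s (12 * m + 16) fun _ s' =>
      (s'.reg 7 = 1 ∧ IsCode c m k (s'.arr 5) ∧ s'.reg 8 = weight m (s'.arr 5) ∧
        Before d (s'.arr 5) ∧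
        ∀ y, IsCode c m k y → Before y (s'.arr 5) → Before y d ∨ y = d) ∨
      (s'.reg 7 = 0 ∧ (∀ i, s'.arr 5 i = 0) ∧ s'.reg 8 = 0 ∧
        ∀ y, IsCode c m k y → Before y d ∨ y = d) := by
  refine Exec.seq (Exec.block 3 rfl (by omega) fun s₁ e₁ f₁ => ?_)
  have hs₁ := hs.of_frame f₁ rfl
  refine Exec.loop (fun τ s' => (s'.reg 16 = 1 ∧ s'.reg 7 = 1 ∧ ∃ i ≤ m, s'.reg 14 = i ∧
      s'.arr 5 = clearBelow i d ∧ s'.reg 8 = weight m (clearBelow i d) ∧ NoneBelow c m k i d ∧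
      12 * (m - i) + 13 ≤ τ) ∨
    (s'.reg 16 = 0 ∧ 1 ≤ τ ∧
      ((s'.reg 7 = 1 ∧ IsCode c m k (s'.arr 5) ∧ s'.reg 8 = weight m (s'.arr 5) ∧
        Before d (s'.arr 5) ∧
        ∀ y, IsCode c m k y → Before y (s'.arr 5) → Before y d ∨ y = d) ∨
      (s'.reg 7 = 0 ∧ (∀ i, s'.arr 5 i = 0) ∧ s'.reg 8 = 0 ∧
        ∀ y, IsCode c m k y → Before y d ∨ y = d)))) ?_ (Or.inl ?_)
  swap
  · have h₀ : clearBelow 0 d = d := by funext j; simp [clearBelow]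
    refine ⟨by simp [e₁, execAll, Instr.exec], by rw [f₁.reg 7 rfl, h7], 0, by omega,
      by simp [e₁, execAll, Instr.exec], ?_, ?_, fun y _ h hh => by omega, by omega⟩
    · rw [f₁.arr 5 rfl, h5, h₀]
    · rw [f₁.reg 8 rfl, h8, h₀]
  rintro τ s₂ f₂ (⟨h16, h7₂, i, hi, h14, h5₂, h8₂, hnone, hτ⟩ | ⟨h16, hτ, hpost⟩)
  swap
  · have hs₂ := hs₁.of_frame f₂ rfl
    refine ⟨hτ, fun hb => ?_, fun _ => hpost⟩
    simp [Test.Holds, h16, hs₂.reg_one] at hb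
  have hs₂ := hs₁.of_frame f₂ rfl
  refine ⟨by omega, fun _ => ?_, fun hb => absurd (by simp [Test.Holds, h16, hs₂.reg_one]) hb⟩
  -- Shared by both kinds of increment: raising a zero adds one to the weight, raising a nonzero
  -- digit leaves it unchanged.
  have hstep : ∀ a, a = d i + 1 → a < c → i < m → ∀ W,
      W + (if d i = 0 then 0 else 1) = weight m (clearBelow i d) + 1 → W ≤ k →
      IsCode c m k (Function.update (clearBelow i d) i a) ∧
      W = weight m (Function.update (clearBelow i d) i a) ∧
      Before d (Function.update (clearBelow i d) i a) ∧
      ∀ y, IsCode c m k y → Before y (Function.update (clearBelow i d) i a) →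
        Before y d ∨ y = d := by
    rintro a rfl hac him W hW hWk
    have hci : clearBelow i d i = d i := by simp [clearBelow]
    have hwt := weight_update him (clearBelow i d) (d i + 1)
    rw [hci, if_neg (Nat.succ_ne_zero _)] at hwt
    have hWeq : W = weight m (Function.update (clearBelow i d) i (d i + 1)) := by omega
    refine ⟨⟨fun j => ?_, fun j hj => ?_, by omega⟩, hWeq, before_update_clearBelow i d,
      fun y hy hb => hnone.before_or_eq hd hy hb⟩
    · by_cases hj : j = i
      · rw [hj, Function.update_self]
        exact hac
      · rw [Function.update_of_ne hj, clearBelow]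
        split_ifs
        · omega
        · exact hd.lt j
    · rw [Function.update_of_ne (by omega), clearBelow, if_neg (by omega), hd.eq_zero j hj]
  refine Exec.cond (by omega) (fun hb => ?_) fun hb => ?_ <;>
    simp only [Test.Holds, h14, hs₂.reg_m] at hb
  · refine Exec.seq (Exec.block 2 rfl (by omega) fun s₃ e₃ f₃ => ?_)
    have hs₃ := hs₂.of_frame f₃ rfl
    have h15 : s₃.reg 15 = d i := by
      simp [e₃, execAll, Instr.exec, h14, h5₂, clearBelow]
    have h14₃ : s₃.reg 14 = i := by rw [f₃.reg 14 rfl, h14]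
    have h5₃ : s₃.arr 5 = clearBelow i d := by rw [f₃.arr 5 rfl, h5₂]
    have h8₃ : s₃.reg 8 = weight m (clearBelow i d) := by rw [f₃.reg 8 rfl, h8₂]
    have h7₃ : s₃.reg 7 = 1 := by rw [f₃.reg 7 rfl, h7₂]
    have h16₃ : s₃.reg 16 = 1 := by rw [f₃.reg 16 rfl, h16]
    have hwt := weight_update hb (clearBelow i d) 0
    have hci : clearBelow i d i = d i := by simp [clearBelow]
    rw [← clearBelow_succ, if_pos rfl, hci] at hwt
    refine Exec.cond (by omega) (fun hb₁ => ?_) fun hb₁ => ?_ <;>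
      simp only [Test.Holds, h15, hs₃.reg_zero] at hb₁
    · rw [if_pos hb₁] at hwt
      refine Exec.cond (by omega) (fun hb₂ => ?_) fun hb₂ => ?_ <;>
        simp only [Test.Holds, h8₃, hs₃.reg_k] at hb₂
      · refine Exec.block 4 rfl (by omega) fun s₄ e₄ f₄ => Or.inr ⟨?_, by omega, Or.inl ?_⟩
        · simp [e₄, execAll, Instr.exec]
        · have h5₄ : s₄.arr 5 = Function.update (clearBelow i d) i 1 := by
            simp [e₄, execAll, Instr.exec, h5₃, h14₃, hs₃.reg_one]
          have h8₄ : s₄.reg 8 = weight m (clearBelow i d) + 1 := by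
            simp [e₄, execAll, Instr.exec, h8₃, hs₃.reg_one]
          rw [h5₄, h8₄]
          exact ⟨by rw [f₄.reg 7 rfl, h7₃],
            hstep 1 (by omega) (by omega) hb _ (by rw [if_pos hb₁]) (by omega)⟩
      · refine Exec.block 2 rfl (by omega) fun s₄ e₄ f₄ => Or.inl ⟨?_, ?_, i + 1, hb, ?_, ?_, ?_,
          hnone.succ_of_weight hb hb₁ (by omega), by omega⟩
        · rw [f₄.reg 16 rfl, h16₃]
        · rw [f₄.reg 7 rfl, h7₃]
        · simp [e₄, execAll, Instr.exec, h14₃, hs₃.reg_one]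
        · rw [f₄.arr 5 rfl, h5₃, clearBelow_succ, ← hb₁, ← hci, Function.update_eq_self]
        · rw [f₄.reg 8 rfl, h8₃]
          omega
    · rw [if_neg hb₁] at hwt
      refine Exec.seq (Exec.block 2 rfl (by omega) fun s₄ e₄ f₄ => ?_)
      have hs₄ := hs₃.of_frame f₄ rfl
      have h15₄ : s₄.reg 15 = d i + 1 := by
        simp [e₄, execAll, Instr.exec, h15, hs₃.reg_one]
      have h14₄ : s₄.reg 14 = i := by rw [f₄.reg 14 rfl, h14₃]
      have h5₄ : s₄.arr 5 = clearBelow i d := by rw [f₄.arr 5 rfl, h5₃]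
      have h8₄ : s₄.reg 8 = weight m (clearBelow i d) := by rw [f₄.reg 8 rfl, h8₃]
      have h7₄ : s₄.reg 7 = 1 := by rw [f₄.reg 7 rfl, h7₃]
      have h16₄ : s₄.reg 16 = 1 := by rw [f₄.reg 16 rfl, h16₃]
      refine Exec.cond (by omega) (fun hb₂ => ?_) fun hb₂ => ?_ <;>
        simp only [Test.Holds, h15₄, hs₄.reg_c] at hb₂
      · refine Exec.block 3 rfl (by omega) fun s₅ e₅ f₅ => Or.inr ⟨?_, by omega, Or.inl ?_⟩
        · simp [e₅, execAll, Instr.exec]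
        · have h5₅ : s₅.arr 5 = Function.update (clearBelow i d) i (d i + 1) := by
            simp [e₅, execAll, Instr.exec, h5₄, h14₄, h15₄]
          rw [h5₅, f₅.reg 8 rfl, h8₄]
          refine ⟨by rw [f₅.reg 7 rfl, h7₄], hstep _ rfl hb₂ hb _ (by rw [if_neg hb₁]) ?_⟩
          exact (weight_clearBelow_le i d).trans hd.weight_le
      · refine Exec.block 4 rfl (by omega) fun s₅ e₅ f₅ => Or.inl ⟨?_, ?_, i + 1, hb, ?_, ?_, ?_,
          hnone.succ_of_max (by omega), by omega⟩
        · rw [f₅.reg 16 rfl, h16₄]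
        · rw [f₅.reg 7 rfl, h7₄]
        · simp [e₅, execAll, Instr.exec, h14₄, hs₄.reg_one]
        · rw [clearBelow_succ]
          simp [e₅, execAll, Instr.exec, h5₄, h14₄, hs₄.reg_zero]
        · simp [e₅, execAll, Instr.exec, h8₄, hs₄.reg_one]
          omega
  · obtain rfl : i = m := by omega
    refine Exec.block 3 rfl (by omega) fun s₃ e₃ f₃ => Or.inr ⟨?_, by omega, Or.inr ⟨?_, ?_, ?_,
      fun y hy => hnone.before_or_eq_of_length hd hy⟩⟩
    · simp [e₃, execAll, Instr.exec]
    · simp [e₃, execAll, Instr.exec]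
    · intro j
      rw [f₃.arr 5 rfl, h5₂, clearBelow]
      split_ifs with hj
      exacts [rfl, hd.eq_zero j (by omega)]
    · rw [f₃.reg 8 rfl, h8₂, weight]
      refine Finset.sum_eq_zero fun j hj => ?_
      simp [clearBelow, Finset.mem_range.1 hj]

end

/-! ### The loops over codes and roots -/

section

variable {n c : ℕ} {G : SimpleGraph (Fin n)}
variable {L : AdjLists G} {ω : Sym2 (Fin n) → ℚ} {χ : Fin n → Fin c} {k m : ℕ} {s s' : State}

/-- No improvement is found with root `v` and code `d`. -/
def Fails (L : AdjLists G) (ω : Sym2 (Fin n) → ℚ) (χ : Fin n → Fin c) (v : Fin n)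
    (d : ℕ → ℕ) : Prop :=
  ∀ r, Explore L χ d [v] χ r →
    totalWeight ω (properEdges G r) ≤ totalWeight ω (properEdges G χ)

/-- An improvement has been found, and the search is about to stop. -/
structure Found (G : SimpleGraph (Fin n)) (ω : Sym2 (Fin n) → ℚ) (χ : Fin n → Fin c) (k : ℕ)
    (s : State) : Prop where
  reg_ans : s.reg 9 = 1
  reg_root : n ≤ s.reg 6
  exists_neighbor : ∃ r : Fin n → Fin c, IsImprovingNeighbor G ω χ k r ∧
    ∀ u : Fin n, s.arr 3 u = r u

/-- No improvement has been found so far, and the root is `v`. -/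
structure Searching (χ : Fin n → Fin c) (v : ℕ) (s : State) : Prop where
  reg_ans : s.reg 9 = 0
  reg_root : s.reg 6 = v
  arr_eq : ∀ u : Fin n, s.arr 3 u = χ u

/-- A bound for the number of steps that are spent on one code. -/
def codeTime (M k m : ℕ) : ℕ := 52 * (M * k) + 12 * m + 80

theorem exec_tryCode (hs : Ready L ω χ k m s) (hc : 2 ≤ c) {M : ℕ}
    (hM : ∀ v, (L.nbrs v).length ≤ M) (v : Fin n) (hsv : Searching χ v s)
    (hd : IsCode c m k (s.arr 5)) (h8 : s.reg 8 = weight m (s.arr 5)) (h7 : s.reg 7 = 1) :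
    Exec tryCode s (codeTime M k m) fun _ s' =>
      (s'.reg 7 = 0 ∧ Found G ω χ k s') ∨
      Searching χ v s' ∧ Fails L ω χ v (s.arr 5) ∧
      ((s'.reg 7 = 1 ∧ IsCode c m k (s'.arr 5) ∧ s'.reg 8 = weight m (s'.arr 5) ∧
        Before (s.arr 5) (s'.arr 5) ∧
        ∀ y, IsCode c m k y → Before y (s'.arr 5) → Before y (s.arr 5) ∨ y = s.arr 5) ∨
      (s'.reg 7 = 0 ∧ (∀ i, s'.arr 5 i = 0) ∧ s'.reg 8 = 0 ∧
        ∀ y, IsCode c m k y → Before y (s.arr 5) ∨ y = s.arr 5)) := by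
  unfold codeTime
  refine Exec.seq ((exec_explore hs hM v hsv.reg_root hsv.arr_eq hd).save
    (46 * (M * k) + 39) (by omega) fun τ s₁ hτ f₁ ⟨q, r, hE, h3, hg, h11, h4, hmem, hq⟩ => ?_)
  have hs₁ := hs.of_frame f₁ rfl
  refine Exec.cond (by omega) (fun hb => ?_) fun hb => ?_ <;>
    simp only [Test.Holds, hg, hs₁.wreg_zero, sub_pos, not_lt] at hb
  -- On success the root register is set to `n`, so both the loop over codes and the loop over roots
  -- stop while array `3` still holds the improvement.
  · refine Exec.block 4 rfl (by omega) fun s₂ e₂ f₂ => Or.inl ⟨?_, ?_, ?_, r, ⟨?_, hb⟩, ?_⟩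
    · simp [e₂, execAll, Instr.exec]
    · simp [e₂, execAll, Instr.exec]
    · simp [e₂, execAll, Instr.exec, hs₁.reg_n]
    · have h₁ := hE.card_flip_le m hd.eq_zero
      have h₂ := hd.weight_le
      have h₃ : (flip χ χ).card = 0 := by simp [flip]
      omega
    · rw [f₂.arr 3 rfl]
      exact h3
  · refine Exec.seq ((exec_undo hs₁ q r h3 h11 h4 hmem).save (6 * q.length + 3) (by omega)
      fun τ₂ s₂ hτ₂ f₂ h3₂ => ?_)
    have hs₂ := hs₁.of_frame f₂ rfl
    refine (exec_nextCode hs₂ hc hd (by rw [f₂.arr 5 rfl, f₁.arr 5 rfl])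
      (by rw [f₂.reg 8 rfl, f₁.reg 8 rfl, h8]) (by rw [f₂.reg 7 rfl, f₁.reg 7 rfl, h7])).save
      (12 * m + 16) (by omega) fun τ₃ s₃ hτ₃ f₃ h => Or.inr ⟨⟨?_, ?_, ?_⟩, ?_, h⟩
    · rw [f₃.reg 9 rfl, f₂.reg 9 rfl, f₁.reg 9 rfl, hsv.reg_ans]
    · rw [f₃.reg 6 rfl, f₂.reg 6 rfl, f₁.reg 6 rfl, hsv.reg_root]
    · rw [f₃.arr 3 rfl]
      exact h3₂
    · intro r' hr'
      rw [hr'.unique hE]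
      exact hb

/-- The enumeration starts at the zero code, which nothing precedes, and each successor step skips
no code. So when it ends, every code has failed for this root. -/
theorem exec_codeLoop (hs : Ready L ω χ k m s) (hc : 2 ≤ c) {M : ℕ}
    (hM : ∀ v, (L.nbrs v).length ≤ M) (v : Fin n) (hsv : Searching χ v s)
    (h5 : ∀ i, s.arr 5 i = 0) (h8 : s.reg 8 = 0) (h7 : s.reg 7 = 1) :
    Exec (Cmd.loop (Test.eq 7 2) tryCode) s
      ((codeTime M k m + 1) * (remaining c m k fun _ => 0).card + 1) fun _ s' =>
      Found G ω χ k s' ∨ Searching χ v s' ∧ (∀ i, s'.arr 5 i = 0) ∧ s'.reg 8 = 0 ∧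
        ∀ y, IsCode c m k y → Fails L ω χ v y := by
  have h5' : s.arr 5 = fun _ => 0 := funext h5
  refine Exec.loop (fun τ s' =>
    (s'.reg 7 = 1 ∧ Searching χ v s' ∧ IsCode c m k (s'.arr 5) ∧ s'.reg 8 = weight m (s'.arr 5) ∧
      (∀ y, IsCode c m k y → Before y (s'.arr 5) → Fails L ω χ v y) ∧
      (codeTime M k m + 1) * (remaining c m k (s'.arr 5)).card + 1 ≤ τ) ∨
    (s'.reg 7 = 0 ∧ 1 ≤ τ ∧ (Found G ω χ k s' ∨ Searching χ v s' ∧ (∀ i, s'.arr 5 i = 0) ∧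
      s'.reg 8 = 0 ∧ ∀ y, IsCode c m k y → Fails L ω χ v y))) ?_
    (Or.inl ⟨h7, hsv, ⟨fun i => ?_, fun i _ => h5 i, ?_⟩, ?_, fun y _ hb => ?_, ?_⟩)
  · rintro τ s₁ f₁ (⟨h7₁, hsv₁, hd, h8₁, hfail, hτ⟩ | ⟨h7₁, hτ, hpost⟩)
    · have hs₁ := hs.of_frame f₁ rfl
      have hcard := Nat.mul_le_mul_left (codeTime M k m + 1) (one_le_card_remaining hd)
      refine ⟨by omega, fun _ => ?_, fun hb => absurd (by simp [Test.Holds, h7₁, hs₁.reg_one]) hb⟩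
      refine (exec_tryCode hs₁ hc hM v hsv₁ hd h8₁ h7₁).save (codeTime M k m) (by omega)
        fun τ₂ s₂ hτ₂ f₂ h => ?_
      rcases h with ⟨h7₂, h⟩ | ⟨hsv₂, hf, ⟨h7₂, hd₂, h8₂, hlt, hnext⟩ | ⟨h7₂, h5₂, h8₂, hlast⟩⟩
      · exact Or.inr ⟨h7₂, by omega, Or.inl h⟩
      · refine Or.inl ⟨h7₂, hsv₂, hd₂, h8₂, fun y hy hb => ?_, ?_⟩
        · rcases hnext y hy hb with hb | rfl
          exacts [hfail y hy hb, hf]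
        · have := Nat.mul_le_mul_left (codeTime M k m + 1) (card_remaining_lt hd hlt)
          rw [mul_add, mul_one] at this
          omega
      · refine Or.inr ⟨h7₂, by omega, Or.inr ⟨hsv₂, h5₂, h8₂, fun y hy => ?_⟩⟩
        rcases hlast y hy with hb | rfl
        exacts [hfail y hy hb, hf]
    · have hs₁ := hs.of_frame f₁ rfl
      refine ⟨hτ, fun hb => ?_, fun _ => hpost⟩
      simp [Test.Holds, h7₁, hs₁.reg_one] at hb
  · rw [h5]
    omega
  · simp [h5', weight]
  · simp [h5', h8, weight]
  · obtain ⟨h, hh, _⟩ := hb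
    rw [h5] at hh
    omega
  · rw [h5']

theorem exec_search (hs : Ready L ω χ k m s) (hc : 2 ≤ c) {M : ℕ}
    (hM : ∀ v, (L.nbrs v).length ≤ M) (hsv : Searching χ 0 s)
    (h5 : ∀ i, s.arr 5 i = 0) (h8 : s.reg 8 = 0) :
    Exec search s
      (((codeTime M k m + 1) * (remaining c m k fun _ => 0).card + 6) * n + 1) fun _ s' =>
      Found G ω χ k s' ∨ s'.reg 9 = 0 ∧ (∀ u : Fin n, s'.arr 3 u = χ u) ∧
        ∀ v y, IsCode c m k y → Fails L ω χ v y := by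
  set T := (codeTime M k m + 1) * (remaining c m k fun _ => 0).card with hT
  refine Exec.loop (fun τ s' => 1 ≤ τ ∧ (Found G ω χ k s' ∨ ∃ v ≤ n, Searching χ v s' ∧
    (∀ i, s'.arr 5 i = 0) ∧ s'.reg 8 = 0 ∧
    (∀ u : Fin n, (u : ℕ) < v → ∀ y, IsCode c m k y → Fails L ω χ u y) ∧
    (T + 6) * (n - v) + 1 ≤ τ)) ?_
    ⟨by omega, Or.inr ⟨0, by omega, hsv, h5, h8, fun u hu => by omega, by simp⟩⟩
  rintro τ s₁ f₁ ⟨hτ, hf | ⟨v, hv, hsv₁, h5₁, h8₁, hfail, hτ₁⟩⟩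
  · have hs₁ := hs.of_frame f₁ rfl
    refine ⟨hτ, fun hb => ?_, fun _ => Or.inl hf⟩
    simp only [Test.Holds, hs₁.reg_n] at hb
    have := hf.reg_root
    omega
  · have hs₁ := hs.of_frame f₁ rfl
    refine ⟨hτ, fun hb => ?_, fun hb => ?_⟩ <;>
      simp only [Test.Holds, hs₁.reg_n, hsv₁.reg_root] at hb
    · obtain ⟨j, hj⟩ : ∃ j, n - v = j + 1 := ⟨n - v - 1, by omega⟩
      have hj' : n - (v + 1) = j := by omega
      rw [hj, mul_add, mul_one] at hτ₁
      refine Exec.seq (Exec.block 2 rfl (by omega) fun s₂ e₂ f₂ => Exec.seq ?_)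
      have hs₂ := hs₁.of_frame f₂ rfl
      refine (exec_codeLoop hs₂ hc hM ⟨v, hb⟩ ⟨?_, ?_, ?_⟩ ?_ ?_ ?_).save (T + 1) (by omega)
        fun τ₃ s₃ hτ₃ f₃ h => ?_
      · rw [f₂.reg 9 rfl, hsv₁.reg_ans]
      · rw [f₂.reg 6 rfl, hsv₁.reg_root]
      · rw [f₂.arr 3 rfl]
        exact hsv₁.arr_eq
      · rw [f₂.arr 5 rfl]
        exact h5₁
      · rw [f₂.reg 8 rfl, h8₁]
      · simp [e₂, execAll, Instr.exec]
      have hs₃ := hs₂.of_frame f₃ rfl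
      refine Exec.block 2 rfl (by omega) fun s₄ e₄ f₄ => ⟨by omega, ?_⟩
      rcases h with h | ⟨hsv₃, h5₃, h8₃, hf₃⟩
      · refine Or.inl ⟨?_, ?_, ?_⟩
        · rw [f₄.reg 9 rfl, h.reg_ans]
        · have := h.reg_root
          simp [e₄, execAll, Instr.exec]
          omega
        · rw [f₄.arr 3 rfl]
          exact h.exists_neighbor
      · refine Or.inr ⟨v + 1, hb, ⟨?_, ?_, ?_⟩, ?_, ?_, ?_, ?_⟩
        · rw [f₄.reg 9 rfl, hsv₃.reg_ans]
        · simp [e₄, execAll, Instr.exec, hsv₃.reg_root, hs₃.reg_one]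
        · rw [f₄.arr 3 rfl]
          exact hsv₃.arr_eq
        · rw [f₄.arr 5 rfl]
          exact h5₃
        · rw [f₄.reg 8 rfl, h8₃]
        · intro u hu
          rcases (Nat.lt_succ_iff.1 hu).eq_or_lt with huv | huv
          · obtain rfl : u = ⟨v, hb⟩ := Fin.ext huv
            exact hf₃
          · exact hfail u huv
        · rw [hj']
          omega
    · exact Or.inr ⟨hsv₁.reg_ans, hsv₁.arr_eq, fun u => hfail u (by have := u.2; omega)⟩

/-! ### Initialization -/

theorem flatten_getElem {α : Type*} (f : Fin n → List α) (v : Fin n) (i : ℕ)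
    (h : i < (f v).length) :
    (List.ofFn f).flatten[((List.ofFn f).take v).flatten.length + i]? = some (f v)[i] := by
  have hv : (v : ℕ) < (List.ofFn f).length := by simp
  have hl : (List.ofFn f).flatten = ((List.ofFn f).take v).flatten ++
      (f v ++ ((List.ofFn f).drop (v + 1)).flatten) := by
    conv_lhs => rw [← List.take_append_drop (v : ℕ) (List.ofFn f), List.drop_eq_getElem_cons hv]
    simp only [List.flatten_append, List.flatten_cons, List.getElem_ofFn, Fin.eta]
  rw [hl, List.getElem?_append_right (by omega), Nat.add_sub_cancel_left,
    List.getElem?_append_left h, List.getElem?_eq_getElem h]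

theorem stored_inputState (L : AdjLists G) (ω : Sym2 (Fin n) → ℚ) (χ : Fin n → Fin c) (k : ℕ) :
    Stored L ω χ (coloringInput L ω χ k) := by
  refine ⟨fun v => ?_, fun v i h => ?_, fun v i h => ?_, fun v => ?_⟩
  · have hv : (v : ℕ) < (List.ofFn L.nbrs).length := by simp
    have h₁ : (v : ℕ) + 1 ≤ n := v.2
    have h₂ : (v : ℕ) ≤ n := v.2.le
    simp only [coloringInput, inputState, if_true, h₁, h₂]
    rw [← List.take_append_getElem hv, List.flatten_append, List.length_append]
    simp
  · have h₂ : (v : ℕ) ≤ n := v.2.le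
    simp only [coloringInput, inputState, if_true, h₂, one_ne_zero, if_false]
    rw [List.getD_eq_getElem?_getD, List.getElem?_map, flatten_getElem L.nbrs v i h]
    simp
  · have h₂ : (v : ℕ) ≤ n := v.2.le
    simp only [coloringInput, inputState, if_true, h₂]
    -- Attaching weights preserves the lengths of the lists, so the weight array uses the same
    -- starting positions.
    have hlen : ((List.ofFn L.nbrs).take v).flatten.length =
        ((List.ofFn fun v => (L.nbrs v).map fun w => ω s(v, w)).take v).flatten.length := by
      rw [List.length_flatten, List.length_flatten, List.map_take, List.map_take, List.map_ofFn,
        List.map_ofFn]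
      congr 3
      funext u
      simp
    rw [hlen, List.getD_eq_getElem?_getD,
      flatten_getElem (fun v => (L.nbrs v).map fun w => ω s(v, w)) v i (by simpa using h)]
    simp
  · simp [coloringInput, inputState]

theorem length_nbrs [DecidableRel G.Adj] (L : AdjLists G) (v : Fin n) :
    (L.nbrs v).length = G.degree v := by
  rw [← List.toFinset_card_of_nodup (L.nodup v), ← SimpleGraph.card_neighborFinset_eq_degree]
  congr 1
  ext w
  simp [L.mem_iff]

/-- A degree is the difference of two consecutive starting positions. -/
theorem exec_maxDegreeLoop [DecidableRel G.Adj] (hs : Stored L ω χ s) (h0 : s.reg 0 = n)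
    (h2 : s.reg 2 = 1) (h13 : s.reg 13 = 0) (h14 : s.reg 14 = 0) :
    Exec maxDegreeLoop s (9 * n + 1) fun _ s' => s'.reg 13 = G.maxDegree := by
  refine Exec.loop (fun τ s' => ∃ v ≤ n, s'.reg 14 = v ∧ s'.reg 13 ≤ G.maxDegree ∧
    (∀ u : Fin n, (u : ℕ) < v → G.degree u ≤ s'.reg 13) ∧ 9 * (n - v) + 1 ≤ τ) ?_
    ⟨0, by omega, h14, by omega, fun u hu => by omega, by omega⟩
  rintro τ s₁ f₁ ⟨v, hv, hv₁, h13₁, hdeg, hτ⟩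
  have hs₁ := hs.of_frame f₁ rfl
  have h0₁ : s₁.reg 0 = n := by rw [f₁.reg 0 rfl, h0]
  have h2₁ : s₁.reg 2 = 1 := by rw [f₁.reg 2 rfl, h2]
  refine ⟨by omega, fun hb => ?_, fun hb => ?_⟩ <;> simp only [Test.Holds, hv₁, h0₁] at hb
  · have hstart := hs₁.start ⟨v, hb⟩
    rw [length_nbrs] at hstart
    simp only at hstart
    have hle := G.degree_le_maxDegree ⟨v, hb⟩
    refine Exec.seq (Exec.block 5 rfl (by omega) fun s₂ e₂ f₂ => ?_)
    have h14₂ : s₂.reg 14 = v + 1 := by simp [e₂, execAll, Instr.exec, hv₁, h2₁]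
    have h16₂ : s₂.reg 16 = G.degree ⟨v, hb⟩ := by
      simp [e₂, execAll, Instr.exec, hv₁, h2₁, hstart]
    have h13₂ : s₂.reg 13 = s₁.reg 13 := f₂.reg 13 rfl
    refine Exec.cond (by omega) (fun hb₂ => ?_) fun hb₂ => ?_ <;>
      simp only [Test.Holds, h13₂, h16₂] at hb₂
    · refine Exec.block 2 rfl (by omega) fun s₃ e₃ f₃ =>
        ⟨v + 1, hb, by rw [f₃.reg 14 rfl, h14₂], ?_, fun u hu => ?_, by omega⟩ <;>
      have h13₃ : s₃.reg 13 = G.degree ⟨v, hb⟩ := by simp [e₃, execAll, Instr.exec, h16₂]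
      · omega
      · rcases (Nat.lt_succ_iff.1 hu).eq_or_lt with huv | huv
        · obtain rfl : u = ⟨v, hb⟩ := Fin.ext huv
          exact h13₃.ge
        · have := hdeg u huv
          omega
    · refine Exec.block 1 rfl (by omega) fun s₃ e₃ f₃ =>
        ⟨v + 1, hb, by rw [f₃.reg 14 rfl, h14₂], ?_, fun u hu => ?_, by omega⟩ <;>
      rw [f₃.reg 13 rfl, h13₂]
      · exact h13₁
      · rcases (Nat.lt_succ_iff.1 hu).eq_or_lt with huv | huv
        · obtain rfl : u = ⟨v, hb⟩ := Fin.ext huv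
          omega
        · exact hdeg u huv
  · exact le_antisymm h13₁
      (G.maxDegree_le_of_forall_degree_le _ fun u => hdeg u (by have := u.2; omega))

/-- The machine cannot multiply, so the product in the code length is formed by `k` additions; this
accounts for the term `4 * k` in the setup time. -/
theorem exec_lengthLoop (hk : s.reg 1 = k) (h2 : s.reg 2 = 1) (h14 : s.reg 14 = 0) :
    Exec lengthLoop s (4 * k + 1) fun _ s' => s'.reg 5 = k * s.reg 13 + s.reg 5 := by
  refine Exec.loop (fun τ s' => ∃ j ≤ k, s'.reg 14 = j ∧ s'.reg 5 = j * s.reg 13 + s.reg 5 ∧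
    4 * (k - j) + 1 ≤ τ) ?_ ⟨0, by omega, h14, by simp, by omega⟩
  rintro τ s₁ f₁ ⟨j, hj, h14₁, h5₁, hτ⟩
  have hk₁ : s₁.reg 1 = k := by rw [f₁.reg 1 rfl, hk]
  have h2₁ : s₁.reg 2 = 1 := by rw [f₁.reg 2 rfl, h2]
  refine ⟨by omega, fun hb => ?_, fun hb => ?_⟩ <;> simp only [Test.Holds, h14₁, hk₁] at hb
  · refine Exec.block 3 rfl (by omega) fun s₂ e₂ f₂ => ⟨j + 1, hb, ?_, ?_, by omega⟩
    · simp [e₂, execAll, Instr.exec, h14₁, h2₁]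
    · simp [e₂, execAll, Instr.exec, h5₁, f₁.reg 13 rfl]
      ring
  · obtain rfl : j = k := by omega
    exact h5₁

theorem exec_copyLoop (hs : Stored L ω χ s) (h0 : s.reg 0 = n) (h2 : s.reg 2 = 1)
    (h14 : s.reg 14 = 0) :
    Exec copyLoop s (5 * n + 1) fun _ s' => ∀ u : Fin n, s'.arr 3 u = χ u := by
  refine Exec.loop (fun τ s' => ∃ v ≤ n, s'.reg 14 = v ∧
    (∀ u : Fin n, (u : ℕ) < v → s'.arr 3 u = χ u) ∧ 5 * (n - v) + 1 ≤ τ) ?_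
    ⟨0, by omega, h14, fun u hu => by omega, by omega⟩
  rintro τ s₁ f₁ ⟨v, hv, h14₁, h3₁, hτ⟩
  have hs₁ := hs.of_frame f₁ rfl
  have h0₁ : s₁.reg 0 = n := by rw [f₁.reg 0 rfl, h0]
  have h2₁ : s₁.reg 2 = 1 := by rw [f₁.reg 2 rfl, h2]
  refine ⟨by omega, fun hb => ?_, fun hb => ?_⟩ <;> simp only [Test.Holds, h14₁, h0₁] at hb
  · refine Exec.block 4 rfl (by omega) fun s₂ e₂ f₂ => ⟨v + 1, hb, ?_, fun u hu => ?_, by omega⟩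
    · simp [e₂, execAll, Instr.exec, h14₁, h2₁]
    · rcases (Nat.lt_succ_iff.1 hu).eq_or_lt with huv | huv
      · rw [← hs₁.label]
        simp [e₂, execAll, Instr.exec, h14₁, huv]
      · have huv' : (u : ℕ) ≠ v := huv.ne
        rw [← h3₁ u huv]
        simp [e₂, execAll, Instr.exec, h14₁, huv']
  · exact fun u => h3₁ u (by have := u.2; omega)

theorem exec_setup [DecidableRel G.Adj] (L : AdjLists G) (ω : Sym2 (Fin n) → ℚ)
    (χ : Fin n → Fin c) (k : ℕ) :
    Exec (setup c) (coloringInput L ω χ k) (14 * n + 4 * k + 14) fun _ s' =>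
      Ready L ω χ k (k * (G.maxDegree - 1) + 2) s' ∧ Searching χ 0 s' ∧
      (∀ i, s'.arr 5 i = 0) ∧ s'.reg 8 = 0 := by
  have hs := stored_inputState L ω χ k
  have hreg : ∀ x, x ≠ 0 → x ≠ 1 → (coloringInput L ω χ k).reg x = 0 := fun x h₀ h₁ => by
    simp [coloringInput, inputState, h₀, h₁]
  have harr : ∀ i, (coloringInput L ω χ k).arr 5 i = 0 := fun i => by
    simp [coloringInput, inputState]
  have hw : (coloringInput L ω χ k).wreg 1 = 0 := rfl
  have h0 : (coloringInput L ω χ k).reg 0 = n := rfl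
  have h1 : (coloringInput L ω χ k).reg 1 = k := rfl
  generalize coloringInput L ω χ k = s at *
  refine Exec.seq (Exec.block 5 rfl (by omega) fun s₁ e₁ f₁ => ?_)
  have hs₁ := hs.of_frame f₁ rfl
  have h2₁ : s₁.reg 2 = 1 := by simp [e₁, execAll, Instr.exec]
  have h4₁ : s₁.reg 4 = c := by simp [e₁, execAll, Instr.exec]
  refine Exec.seq ((exec_maxDegreeLoop hs₁ (by rw [f₁.reg 0 rfl, h0]) h2₁
    (by simp [e₁, execAll, Instr.exec]) (by simp [e₁, execAll, Instr.exec])).save (9 * n + 1)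
    (by omega) fun τ₂ s₂ hτ₂ f₂ h13 => ?_)
  have hs₂ := hs₁.of_frame f₂ rfl
  have h2₂ : s₂.reg 2 = 1 := by rw [f₂.reg 2 rfl, h2₁]
  refine Exec.seq (Exec.block 4 rfl (by omega) fun s₃ e₃ f₃ => ?_)
  have hs₃ := hs₂.of_frame f₃ rfl
  have h2₃ : s₃.reg 2 = 1 := by rw [f₃.reg 2 rfl, h2₂]
  have h13₃ : s₃.reg 13 = G.maxDegree - 1 := by simp [e₃, execAll, Instr.exec, h13, h2₂]
  have h5₃ : s₃.reg 5 = 2 := by simp [e₃, execAll, Instr.exec]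
  refine Exec.seq ((exec_lengthLoop (k := k) ?_ h2₃ (by simp [e₃, execAll, Instr.exec])).save
    (4 * k + 1) (by omega) fun τ₄ s₄ hτ₄ f₄ h5₄ => ?_)
  · rw [f₃.reg 1 rfl, f₂.reg 1 rfl, f₁.reg 1 rfl, h1]
  have hs₄ := hs₃.of_frame f₄ rfl
  rw [h13₃, h5₃] at h5₄
  refine Exec.seq (Exec.block 2 rfl (by omega) fun s₅ e₅ f₅ => ?_)
  have hs₅ := hs₄.of_frame f₅ rfl
  have h0₅ : s₅.reg 0 = n := by
    rw [f₅.reg 0 rfl, f₄.reg 0 rfl, f₃.reg 0 rfl, f₂.reg 0 rfl, f₁.reg 0 rfl, h0]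
  have h2₅ : s₅.reg 2 = 1 := by rw [f₅.reg 2 rfl, f₄.reg 2 rfl, h2₃]
  refine (exec_copyLoop hs₅ h0₅ h2₅ (by simp [e₅, execAll, Instr.exec])).save (5 * n + 1)
    (by omega) fun τ₆ s₆ hτ₆ f₆ h3 => ⟨⟨hs₅.of_frame f₆ rfl, ?_, ?_, ?_, ?_, ?_, ?_, ?_⟩,
      ⟨?_, ?_, h3⟩, ?_, ?_⟩
  · rw [f₆.reg 0 rfl, h0₅]
  · rw [f₆.reg 1 rfl, f₅.reg 1 rfl, f₄.reg 1 rfl, f₃.reg 1 rfl, f₂.reg 1 rfl, f₁.reg 1 rfl, h1]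
  · rw [f₆.reg 2 rfl, h2₅]
  · rw [f₆.reg 3 rfl, f₅.reg 3 rfl, f₄.reg 3 rfl, f₃.reg 3 rfl, f₂.reg 3 rfl, f₁.reg 3 rfl,
      hreg 3 (by omega) (by omega)]
  · rw [f₆.reg 4 rfl, f₅.reg 4 rfl, f₄.reg 4 rfl, f₃.reg 4 rfl, f₂.reg 4 rfl, h4₁]
  · rw [f₆.reg 5 rfl, f₅.reg 5 rfl, h5₄]
  · rw [f₆.wreg 1 rfl, f₅.wreg 1 rfl, f₄.wreg 1 rfl, f₃.wreg 1 rfl, f₂.wreg 1 rfl, f₁.wreg 1 rfl,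
      hw]
  · rw [f₆.reg 9 rfl, f₅.reg 9 rfl, f₄.reg 9 rfl, f₃.reg 9 rfl, f₂.reg 9 rfl, f₁.reg 9 rfl,
      hreg 9 (by omega) (by omega)]
  · rw [f₆.reg 6 rfl, f₅.reg 6 rfl, f₄.reg 6 rfl, f₃.reg 6 rfl, f₂.reg 6 rfl, f₁.reg 6 rfl,
      hreg 6 (by omega) (by omega)]
  · rw [f₆.arr 5 rfl, f₅.arr 5 rfl, f₄.arr 5 rfl, f₃.arr 5 rfl, f₂.arr 5 rfl, f₁.arr 5 rfl]
    exact harr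
  · rw [f₆.reg 8 rfl, f₅.reg 8 rfl, f₄.reg 8 rfl, f₃.reg 8 rfl, f₂.reg 8 rfl, f₁.reg 8 rfl,
      hreg 8 (by omega) (by omega)]

end

/-! ### Total running time and correctness -/

section

variable {n c : ℕ} {G : SimpleGraph (Fin n)}

/-- A bound for the number of steps of the local search. -/
noncomputable def searchTime (n c k Δ : ℕ) : ℕ :=
  14 * n + 4 * k + 15 + ((codeTime Δ k (k * (Δ - 1) + 2) + 1) *
    (remaining c (k * (Δ - 1) + 2) k fun _ => 0).card + 6) * n

/-- The summand `9 * n + 5` leaves room for turning the final coloring into a characteristic vector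
in `cutProgram`. -/
theorem searchTime_le {n c k Δ : ℕ} (hn : 1 ≤ n) (hc : 2 ≤ c) (hk : 1 ≤ k) (hΔ : 2 ≤ Δ) :
    (searchTime n c k Δ : ℝ) + 9 * n + 5 ≤ 300 * Real.exp 2 *
      ((((c : ℝ) - 1) * Real.exp 1) ^ k * ((Δ : ℝ) - 1) ^ (k + 1) * (k : ℝ) ^ 2 * n) := by
  obtain ⟨D, rfl⟩ : ∃ D, Δ = D + 1 := ⟨Δ - 1, by omega⟩
  have hD : 1 ≤ D := by omega
  have hN := card_remaining_le_pow hc hk hD fun _ => 0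
  rw [searchTime, codeTime, Nat.add_sub_cancel]
  push_cast
  rw [add_sub_cancel_right]
  generalize ((remaining c (k * D + 2) k fun _ => 0).card : ℝ) = N at *
  have hc' : (1 : ℝ) ≤ (c : ℝ) - 1 := by
    have : (2 : ℝ) ≤ c := by exact_mod_cast hc
    linarith
  have hn' : (1 : ℝ) ≤ n := by exact_mod_cast hn
  have hk' : (1 : ℝ) ≤ k := by exact_mod_cast hk
  have hD' : (1 : ℝ) ≤ D := by exact_mod_cast hD
  have he : (1 : ℝ) ≤ Real.exp 1 := Real.one_le_exp zero_le_one
  have hX : (1 : ℝ) ≤ Real.exp 2 * ((((c : ℝ) - 1) * Real.exp 1) ^ k * (D : ℝ) ^ k) :=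
    one_le_mul_of_one_le_of_one_le (Real.one_le_exp zero_le_two)
      (one_le_mul_of_one_le_of_one_le
        (one_le_pow₀ (one_le_mul_of_one_le_of_one_le hc' he)) (one_le_pow₀ hD'))
  have hgoal : 300 * Real.exp 2 *
      ((((c : ℝ) - 1) * Real.exp 1) ^ k * (D : ℝ) ^ (k + 1) * (k : ℝ) ^ 2 * n) =
      300 * (Real.exp 2 * ((((c : ℝ) - 1) * Real.exp 1) ^ k * (D : ℝ) ^ k)) * (k * D) * n * k := by
    ring
  rw [hgoal]
  generalize Real.exp 2 * ((((c : ℝ) - 1) * Real.exp 1) ^ k * (D : ℝ) ^ k) = X at *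
  have hkD : (k : ℝ) ≤ k * D := le_mul_of_one_le_right (by linarith) hD'
  have hkD₁ : (1 : ℝ) ≤ k * D := hk'.trans hkD
  have hY : (k : ℝ) * D ≤ X * (k * D) := le_mul_of_one_le_left (by linarith) hX
  have hY₁ : (1 : ℝ) ≤ X * (k * D) := hkD₁.trans hY
  have h₁ : (52 * (((D : ℝ) + 1) * k) + 12 * (k * D + 2) + 80 + 1) * N ≤
      221 * (X * (k * D)) := by
    -- From `D ≥ 1` and `k * D ≥ 1`: 104 for the first term, 12 for the second, and 24 + 81 for the
    -- constants.
    have h : 52 * (((D : ℝ) + 1) * k) + 12 * (k * D + 2) + 80 + 1 ≤ 221 * (k * D) := by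
      linarith
    calc _ ≤ (52 * (((D : ℝ) + 1) * k) + 12 * (k * D + 2) + 80 + 1) * X := by gcongr
      _ ≤ 221 * (k * D) * X := by gcongr
      _ = _ := by ring
  have h₂ : 14 * (n : ℝ) + 4 * k + 15 +
      ((52 * (((D : ℝ) + 1) * k) + 12 * (k * D + 2) + 80 + 1) * N + 6) * n + 9 * n + 5 ≤
      300 * (X * (k * D)) * n := by
    have h₃ : (n : ℝ) ≤ X * (k * D) * n := le_mul_of_one_le_left (by linarith) hY₁
    have h₄ : X * (k * D) ≤ X * (k * D) * n := le_mul_of_one_le_right (by linarith) hn'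
    have h₅ := mul_le_mul_of_nonneg_right h₁ (by linarith : (0 : ℝ) ≤ n)
    nlinarith
  have h₃ : (0 : ℝ) ≤ 300 * (X * (k * D)) * n := mul_nonneg (by linarith) (by linarith)
  -- The estimate so far is linear in `k`; the second factor `k` of the claimed bound is slack.
  exact h₂.trans ((le_mul_of_one_le_right h₃ hk').trans_eq (by ring))

theorem one_le_of_maxDegree [DecidableRel G.Adj] (h : 2 ≤ G.maxDegree) : 1 ≤ n := by
  by_contra hn
  obtain rfl : n = 0 := by omega
  have := G.maxDegree_le_of_forall_degree_le 0 fun v => v.elim0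
  omega

/-- No lower bound on `Δ` or `k` is needed for correctness: the truncated `Δ - 1` still satisfies `Δ
≤ (Δ - 1) + 1`. In the negative case array `3` equals `χ`, so later processing can treat both
outcomes alike. -/
theorem exec_localSearch [DecidableRel G.Adj] (hc : 2 ≤ c) (L : AdjLists G)
    (ω : Sym2 (Fin n) → ℚ) (χ : Fin n → Fin c) (k : ℕ) :
    Exec (localSearch c) (coloringInput L ω χ k) (searchTime n c k G.maxDegree) fun _ s' =>
      Ready L ω χ k (k * (G.maxDegree - 1) + 2) s' ∧
      ((s'.reg 9 = 1 ∧ ∃ r, IsImprovingNeighbor G ω χ k r ∧ ∀ u : Fin n, s'.arr 3 u = r u) ∨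
        (s'.reg 9 = 0 ∧ ¬ ∃ r, IsImprovingNeighbor G ω χ k r) ∧
          ∀ u : Fin n, s'.arr 3 u = χ u) := by
  have hlen : ∀ v, (L.nbrs v).length ≤ G.maxDegree := fun v => by
    rw [length_nbrs]
    exact G.degree_le_maxDegree v
  unfold searchTime
  refine Exec.seq ((exec_setup L ω χ k).save (14 * n + 4 * k + 14) (by omega)
    fun τ₁ s₁ hτ₁ f₁ ⟨hs₁, hsv, h5, h8⟩ => ?_)
  refine (exec_search hs₁ hc hlen hsv h5 h8).mono (by omega) fun _ s₂ f₂ h =>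
    ⟨hs₁.of_frame f₂ rfl, ?_⟩
  rcases h with h | ⟨h9, h3, hfail⟩
  · exact Or.inl ⟨h.reg_ans, h.exists_neighbor⟩
  · refine Or.inr ⟨⟨h9, fun hex => ?_⟩, h3⟩
    obtain ⟨v, d, r, hd, hE, hlt⟩ := exists_code (L := L) (by omega) ω (D := G.maxDegree - 1)
      (fun v => by have := hlen v; omega) hex
    exact absurd (hfail v d hd r hE) (not_le.2 hlt)

theorem coloringProgram_correct [DecidableRel G.Adj] (hc : 2 ≤ c) (L : AdjLists G)
    (ω : Sym2 (Fin n) → ℚ) (χ : Fin n → Fin c) (k : ℕ) :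
    ∃ t s, Runs (coloringProgram c) (coloringInput L ω χ k) t s ∧ ColoringAnswer G ω χ k s ∧
      (2 ≤ G.maxDegree → 1 ≤ k → (t : ℝ) ≤ 300 * Real.exp 2 *
        ((((c : ℝ) - 1) * Real.exp 1) ^ k * ((G.maxDegree : ℝ) - 1) ^ (k + 1) * (k : ℝ) ^ 2 *
          n)) := by
  have H : Exec (coloringProgram c) (coloringInput L ω χ k) (searchTime n c k G.maxDegree + 2)
      fun _ s' => ColoringAnswer G ω χ k s' := by
    refine Exec.seq ((exec_localSearch hc L ω χ k).save (searchTime n c k G.maxDegree) (by omega)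
      fun τ₁ s₁ hτ₁ f₁ ⟨_, h⟩ => Exec.block 2 rfl (by omega) fun s₂ e₂ f₂ => ?_)
    have h0 : s₂.reg 0 = s₁.reg 9 := by simp [e₂, execAll, Instr.exec]
    rw [ColoringAnswer, h0, f₂.arr 3 rfl]
    exact h.imp_right And.left
  obtain ⟨t, s, _, hr, ht, hans⟩ := H
  refine ⟨t, s, hr, hans, fun hΔ hk => ?_⟩
  have h := searchTime_le (one_le_of_maxDegree hΔ) hc hk hΔ
  have ht' : (t : ℝ) ≤ (searchTime n c k G.maxDegree : ℝ) + 2 := by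
    exact_mod_cast (show t ≤ searchTime n c k G.maxDegree + 2 by omega)
  have hn : (0 : ℝ) ≤ n := n.cast_nonneg
  linarith

/-! ### Partitions as colorings with two colors -/

/-- The coloring with color `1` on `B` and color `0` elsewhere. -/
def colorOf (B : Finset (Fin n)) : Fin n → Fin 2 := fun v => if v ∈ B then 1 else 0

theorem edgesBetween_compl (B : Finset (Fin n)) :
    edgesBetween G Bᶜ B = properEdges G (colorOf B) := by
  ext e
  refine and_congr_right fun _ => ⟨?_, ?_⟩
  · rintro ⟨u, hu, v, hv, rfl⟩
    refine ⟨u, v, rfl, ?_⟩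
    rw [Finset.mem_compl] at hu
    simp [colorOf, hu, hv]
  · rintro ⟨u, v, rfl, h⟩
    by_cases hu : u ∈ B <;> by_cases hv : v ∈ B <;> simp [colorOf, hu, hv] at h
    · exact ⟨v, by simpa using hv, u, hu, Sym2.eq_swap⟩
    · exact ⟨u, by simpa using hu, v, hv, rfl⟩

theorem flip_colorOf (B S : Finset (Fin n)) : flip (colorOf B) (colorOf (symmDiff B S)) = S := by
  ext v
  by_cases hB : v ∈ B <;> by_cases hS : v ∈ S <;>
    simp [flip, colorOf, Finset.mem_symmDiff, hB, hS]

theorem colorOf_symmDiff_flip (B : Finset (Fin n)) (r : Fin n → Fin 2) :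
    colorOf (symmDiff B (flip (colorOf B) r)) = r := by
  funext v
  have h : r v = 0 ∨ r v = 1 := by omega
  have hmem : v ∈ flip (colorOf B) r ↔ colorOf B v ≠ r v := by simp [flip]
  by_cases hB : v ∈ B <;> rcases h with h | h <;>
    simp [colorOf, Finset.mem_symmDiff, hB, h] at hmem ⊢ <;> exact hmem

/-- With two colors a flip set determines the new coloring, so flips and neighboring colorings
correspond bijectively, and the symmetric difference respects complements. -/
theorem isImprovingFlip_iff (ω : Sym2 (Fin n) → ℚ) (B S : Finset (Fin n)) (k : ℕ) :
    IsImprovingFlip G ω Bᶜ B k S ↔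
      IsImprovingNeighbor G ω (colorOf B) k (colorOf (symmDiff B S)) := by
  have h : symmDiff Bᶜ S = (symmDiff B S)ᶜ := by
    ext v
    by_cases hB : v ∈ B <;> by_cases hS : v ∈ S <;> simp [Finset.mem_symmDiff, hB, hS]
  rw [IsImprovingFlip, IsImprovingNeighbor, h, edgesBetween_compl, edgesBetween_compl,
    flip_colorOf]

theorem cutInput_eq (L : AdjLists G) (ω : Sym2 (Fin n) → ℚ) (A B : Finset (Fin n)) (k : ℕ) :
    cutInput L ω A B k = coloringInput L ω (colorOf B) k := by
  rw [cutInput, coloringInput]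
  congr 1
  funext v
  by_cases h : v ∈ B <;> simp [colorOf, h]

theorem exec_markLoop {L : AdjLists G} {ω : Sym2 (Fin n) → ℚ} {χ : Fin n → Fin c} {k m : ℕ}
    {s : State} (hs : Ready L ω χ k m s) (r : Fin n → Fin c)
    (h3 : ∀ u : Fin n, s.arr 3 u = r u) (h14 : s.reg 14 = 0) :
    Exec markLoop s (9 * n + 1) fun _ s' =>
      ∀ u : Fin n, s'.arr 3 u = if u ∈ flip χ r then 1 else 0 := by
  -- The array is overwritten in place: marks below `v`, colors from `v` on.
  refine Exec.loop (fun τ s' => ∃ v ≤ n, s'.reg 14 = v ∧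
    (∀ u : Fin n, s'.arr 3 u = if (u : ℕ) < v then if u ∈ flip χ r then 1 else 0 else (r u : ℕ)) ∧
    9 * (n - v) + 1 ≤ τ) ?_ ⟨0, by omega, h14, fun u => by simpa using h3 u, by omega⟩
  rintro τ s₁ f₁ ⟨v, hv, h14₁, h3₁, hτ⟩
  have hs₁ := hs.of_frame f₁ rfl
  refine ⟨by omega, fun hb => ?_, fun hb => ?_⟩ <;>
    simp only [Test.Holds, h14₁, hs₁.reg_n] at hb
  · refine Exec.seq (Exec.block 3 rfl (by omega) fun s₂ e₂ f₂ => Exec.seq ?_)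
    have hs₂ := hs₁.of_frame f₂ rfl
    have h15 : s₂.reg 15 = χ ⟨v, hb⟩ := by
      rw [← hs₁.label]
      simp [e₂, execAll, Instr.exec, h14₁]
    have h16 : s₂.reg 16 = r ⟨v, hb⟩ := by
      have h := h3₁ ⟨v, hb⟩
      simp only [lt_irrefl, if_false] at h
      rw [← h]
      simp [e₂, execAll, Instr.exec, h14₁]
    have h14₂ : s₂.reg 14 = v := by rw [f₂.reg 14 rfl, h14₁]
    refine (show Exec _ s₂ 3 fun _ s₃ => s₃.reg 14 = v ∧ ∀ u : Fin n, s₃.arr 3 u =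
        if (u : ℕ) = v then if χ ⟨v, hb⟩ = r ⟨v, hb⟩ then 0 else 1 else s₁.arr 3 u from ?_).save 3
      (by omega) fun τ₃ s₃ hτ₃ f₃ ⟨h14₃, h3₃⟩ => ?_
    · refine Exec.cond (by omega) (fun hb₂ => ?_) fun hb₂ => ?_ <;>
        simp only [Test.Holds, h15, h16, Fin.val_inj] at hb₂ <;>
        refine Exec.block 2 rfl (by omega) fun s₃ e₃ f₃ => ⟨by rw [f₃.reg 14 rfl, h14₂],
          fun u => ?_⟩ <;>
        by_cases huv : (u : ℕ) = v <;>
        simp [e₃, execAll, Instr.exec, h14₂, huv, hb₂, hs₂.reg_zero, hs₂.reg_one, f₂.arr 3 rfl]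
    · have hs₃ := hs₂.of_frame f₃ rfl
      refine Exec.block 2 rfl (by omega) fun s₄ e₄ f₄ => ⟨v + 1, hb, ?_, fun u => ?_, by omega⟩
      · simp [e₄, execAll, Instr.exec, h14₃, hs₃.reg_one]
      · rw [f₄.arr 3 rfl, h3₃]
        by_cases huv : (u : ℕ) = v
        · obtain rfl : u = ⟨v, hb⟩ := Fin.ext huv
          by_cases hχ : χ ⟨v, hb⟩ = r ⟨v, hb⟩ <;> simp [flip, hχ]
        · have : (u : ℕ) < v + 1 ↔ (u : ℕ) < v := by omega
          rw [if_neg huv, h3₁]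
          simp only [this]
  · intro u
    rw [h3₁, if_pos (by have := u.2; omega)]

theorem cutProgram_correct [DecidableRel G.Adj] (L : AdjLists G) (ω : Sym2 (Fin n) → ℚ)
    (A B : Finset (Fin n)) (hAB : IsCompl A B) (k : ℕ) :
    ∃ t s, Runs cutProgram (cutInput L ω A B k) t s ∧ CutAnswer G ω A B k s ∧
      (2 ≤ G.maxDegree → 1 ≤ k → (t : ℝ) ≤ 300 * Real.exp 2 *
        (Real.exp 1 ^ k * ((G.maxDegree : ℝ) - 1) ^ (k + 1) * (k : ℝ) ^ 2 * n)) := by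
  obtain rfl : A = Bᶜ := hAB.eq_compl
  rw [cutInput_eq]
  set χ := colorOf B with hχ
  have H : Exec cutProgram (coloringInput L ω χ k)
      (searchTime n 2 k G.maxDegree + (9 * n + 5)) fun _ s' => CutAnswer G ω Bᶜ B k s' := by
    refine Exec.seq ((exec_localSearch le_rfl L ω χ k).save (searchTime n 2 k G.maxDegree)
      (by omega) fun τ₁ s₁ hτ₁ f₁ ⟨hs₁, h⟩ => Exec.seq ?_)
    refine Exec.block 2 rfl (by omega) fun s₂ e₂ f₂ => Exec.seq ?_
    have hs₂ := hs₁.of_frame f₂ rfl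
    have h14 : s₂.reg 14 = 0 := by simp [e₂, execAll, Instr.exec]
    obtain ⟨r, h3, h⟩ : ∃ r : Fin n → Fin 2, (∀ u : Fin n, s₁.arr 3 u = r u) ∧
        (s₁.reg 9 = 1 ∧ IsImprovingNeighbor G ω χ k r ∨
          s₁.reg 9 = 0 ∧ ¬ ∃ r, IsImprovingNeighbor G ω χ k r) := by
      rcases h with ⟨h9, r, hr, h3⟩ | ⟨h9, h3⟩
      exacts [⟨r, h3, Or.inl ⟨h9, hr⟩⟩, ⟨χ, h3, Or.inr h9⟩]
    refine (exec_markLoop hs₂ r (by rw [f₂.arr 3 rfl]; exact h3) h14).save (9 * n + 1) (by omega)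
      fun τ₃ s₃ hτ₃ f₃ h3₃ => Exec.block 2 rfl (by omega) fun s₄ e₄ f₄ => ?_
    have h0 : s₄.reg 0 = s₁.reg 9 := by
      rw [← f₂.reg 9 rfl, ← f₃.reg 9 rfl]
      simp [e₄, execAll, Instr.exec]
    rw [CutAnswer, h0, f₄.arr 3 rfl]
    refine h.imp (fun ⟨h9, hr⟩ => ⟨h9, flip χ r, ?_, h3₃⟩) fun ⟨h9, hr⟩ => ⟨h9, ?_⟩
    · rw [isImprovingFlip_iff, colorOf_symmDiff_flip]
      exact hr
    · rintro ⟨S, hS⟩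
      exact hr ⟨_, (isImprovingFlip_iff ω B S k).1 hS⟩
  obtain ⟨t, s, _, hr, ht, hans⟩ := H
  refine ⟨t, s, hr, hans, fun hΔ hk => ?_⟩
  have h := searchTime_le (one_le_of_maxDegree hΔ) le_rfl hk hΔ
  have ht' : (t : ℝ) ≤ (searchTime n 2 k G.maxDegree : ℝ) + (9 * n + 5) := by
    exact_mod_cast (show t ≤ searchTime n 2 k G.maxDegree + (9 * n + 5) by omega)
  have h2 : ((2 : ℕ) : ℝ) - 1 = 1 := by norm_num
  rw [h2, one_mul] at h
  linarith

end

end LocalCut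

/-! ### The cases of two and three colors -/

theorem mainTheorem9 :
    (∃ (P : LocalCut.Cmd) (C : ℝ),
      ∀ (n : ℕ) (G : SimpleGraph (Fin n)) [DecidableRel G.Adj] (L : LocalCut.AdjLists G)
        (ω : Sym2 (Fin n) → ℚ) (A B : Finset (Fin n)) (_hAB : IsCompl A B) (k : ℕ),
        ∃ (t : ℕ) (s : LocalCut.State),
          LocalCut.Runs P (LocalCut.cutInput L ω A B k) t s ∧
          LocalCut.CutAnswer G ω A B k s ∧
          (2 ≤ G.maxDegree → 1 ≤ k →
            (t : ℝ) ≤ C * (Real.exp 1 ^ k * ((G.maxDegree : ℝ) - 1) ^ (k + 1) * (k : ℝ) ^ 2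
              * (n : ℝ)))) ∧
    (∃ (P : LocalCut.Cmd) (C : ℝ),
      ∀ (n : ℕ) (G : SimpleGraph (Fin n)) [DecidableRel G.Adj] (L : LocalCut.AdjLists G)
        (ω : Sym2 (Fin n) → ℚ) (χ : Fin n → Fin 3) (k : ℕ),
        ∃ (t : ℕ) (s : LocalCut.State),
          LocalCut.Runs P (LocalCut.coloringInput L ω χ k) t s ∧
          LocalCut.ColoringAnswer G ω χ k s ∧
          (2 ≤ G.maxDegree → 1 ≤ k →
            (t : ℝ) ≤ C * ((2 * Real.exp 1) ^ k * ((G.maxDegree : ℝ) - 1) ^ (k + 1) * (k : ℝ) ^ 2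
              * (n : ℝ)))) := by
  refine ⟨⟨LocalCut.cutProgram, 300 * Real.exp 2, fun n G _ L ω A B hAB k =>
    LocalCut.cutProgram_correct L ω A B hAB k⟩,
    LocalCut.coloringProgram 3, 300 * Real.exp 2, fun n G _ L ω χ k => ?_⟩
  have h := LocalCut.coloringProgram_correct (by omega) L ω χ k
  have h3 : ((3 : ℕ) : ℝ) - 1 = 2 := by norm_num
  rwa [h3] at h
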